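/- There is a universal constant $K>0$ such that the following holds. Let $q\ge 2$, let $\phi:\mathbb{R}\to\mathbb{R}$ be 1-Lipschitz and 1-positive-homogeneous ($\phi(ct)=c\,\phi(t)$ for all $c>0$, $t\in\mathbb{R}$), and let $\mathcal{M}=(m_1,\dots,m_{q-1})$ be a sequence of hidden layer sizes. For $\Theta=(W_1,\dots,W_q)$ with $W_1\in\mathbb{R}^{m_1\times d}$, $W_i\in\mathbb{R}^{m_i\times m_{i-1}}$ for $2\le i\le q-1$, and $W_q\in\mathbb{R}^{1\times m_{q-1}}$, let $$f(x;\Theta)=W_q\,\phi(W_{q-1}\,\phi(\cdots\phi(W_1x)\cdots)),$$ with $\phi$ applied entrywise, and let $\|\Theta\|_F=\big(\sum_{j=1}^q\|W_j\|_F^2\big)^{1/2}$. Let $\mathcal{X}\subset\mathbb{R}^d$ be bounded, let $C=\sup_{x\in\mathcal{X}}\|x\|_2$, and let $p_{\rm data}$ be a probability distribution supported on $\mathcal{X}\times\{-1,1\}$. Let $L(\Theta)=\Pr_{(x,y)\sim p_{\rm data}}[y f(x;\Theta)\le 0]$ be the population 0-1 loss. Given $n\ge 1$ samples $(x_1,y_1),\dots,(x_n,y_n)$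 and $\lambda>0$, define $$L_{\lambda,\mathcal{M}}(\Theta)=\frac1n\sum_{i=1}^n\log\big(1+\exp(-y_if(x_i;\Theta))\big)+\lambda\|\Theta\|_F^2,\qquad \gamma^{\star,\mathcal{M}}=\max_{\|\Theta\|_F\le 1}\ \min_{1\le i\le n} y_if(x_i;\Theta).$$ Let $0<\delta\le 1$. Then, with probability at least $1-\delta$ over the i.i.d. draw of $(x_1,y_1),\dots,(x_n,y_n)$ from $p_{\rm data}$, the loss $L_{\lambda,\mathcal{M}}$ has a minimizer for every $\lambda>0$, and, if $\gamma^{\star,\mathcal{M}}>0$, then for every choice of minimizers $\Theta_{\lambda,\mathcal{M}}\in\arg\min_\Theta L_{\lambda,\mathcal{M}}(\Theta)$, $\lambda>0$, $$\limsup_{\lambda\to0^+}L(\Theta_{\lambda,\mathcal{M}})\le K\left(\frac{C}{\gamma^{\star,\mathcal{M}}\,q^{(q-1)/2}\sqrt n}+\epsilon(\gamma^{\star,\mathcal{M}})\right),\qquad \epsilon(\gamma)=\sqrt{\frac{\log\log_2(4C/\gamma)}{n}}+\sqrt{\frac{\log(1/\delta)}{n}}.$$ In particular the constant $K$ does not depend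 on $\mathcal{M}$, $d$, $q$, $\phi$, $\mathcal{X}$, $p_{\rm data}$, $n$ or $\delta$. -/

import Mathlib

open MeasureTheory Filter Topology

noncomputable section

namespace MarginNet

/-- The layer sizes `(d, m₁, …, m_h)`: input dimension followed by the hidden widths. -/
abbrev layerWidth (d : ℕ) {h : ℕ} (m : Fin h → ℕ) : Fin (h + 1) → ℕ :=
  Fin.cons (α := fun _ => ℕ) d m

/-- Parameters `Θ = (W₁, …, W_q)` of a network with `h = q - 1` hidden layers of sizes `m`:
the matrices `W₁, …, W_{q-1}` of the hidden layers, and the output matrix `W_q`, a single row. -/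
abbrev Params (d : ℕ) {h : ℕ} (m : Fin h → ℕ) : Type :=
  ((i : Fin h) →
    Matrix (Fin (layerWidth d m i.succ)) (Fin (layerWidth d m i.castSucc)) ℝ) ×
  Matrix (Fin 1) (Fin (layerWidth d m (Fin.last h))) ℝ

/-- The Euclidean (Frobenius) norm of the collection of all weights. -/
def frobNorm {d h : ℕ} {m : Fin h → ℕ} (Θ : Params d m) : ℝ :=
  Real.sqrt ((∑ i, ∑ a, ∑ b, (Θ.1 i a b) ^ 2) + ∑ a, ∑ b, (Θ.2 a b) ^ 2)

/-- The vector of values at layer `k`: layer `0` is the input, and layer `i + 1` is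
`φ (W_{i+1} z)`, with `φ` applied entrywise to the image of the values `z` at layer `i`. -/
def layer (φ : ℝ → ℝ) {d h : ℕ} {m : Fin h → ℕ} (Θ : Params d m)
    (x : EuclideanSpace ℝ (Fin d)) (k : Fin (h + 1)) : Fin (layerWidth d m k) → ℝ :=
  Fin.induction (motive := fun k => Fin (layerWidth d m k) → ℝ)
    (fun j => x j) (fun i z => fun a => φ ((Θ.1 i).mulVec z a)) k

/-- The score `f(x; Θ) = W_q φ(W_{q-1} φ(⋯ φ(W₁ x) ⋯))`. -/
def net (φ : ℝ → ℝ) {d h : ℕ} {m : Fin h → ℕ} (Θ : Params d m)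
    (x : EuclideanSpace ℝ (Fin d)) : ℝ :=
  Θ.2.mulVec (layer φ Θ x (Fin.last h)) 0

/-- A labelled sample `((x₁, y₁), …, (x_n, y_n))`; labels are real numbers, meant to be `±1`. -/
abbrev Sample (d n : ℕ) : Type := Fin n → EuclideanSpace ℝ (Fin d) × ℝ

/-- The `ℓ₂`-regularized logistic loss
`L_lam(Θ) = (1/n) ∑ log (1 + exp (-yᵢ f(xᵢ; Θ))) + lam ‖Θ‖_F²`. -/
def regLoss (φ : ℝ → ℝ) {d h n : ℕ} {m : Fin h → ℕ} (S : Sample d n) (lam : ℝ)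
    (Θ : Params d m) : ℝ :=
  (1 / (n : ℝ)) * ∑ i, Real.log (1 + Real.exp (-((S i).2 * net φ Θ (S i).1)))
    + lam * frobNorm Θ ^ 2

/-- The margin `min_i yᵢ f(xᵢ; Θ)` of the network on the sample (for `n ≥ 1`). -/
def margin (φ : ℝ → ℝ) {d h n : ℕ} {m : Fin h → ℕ} (S : Sample d n) (Θ : Params d m) : ℝ :=
  ⨅ i, (S i).2 * net φ Θ (S i).1

/-- The max normalized margin `γ⋆ = max_{‖Θ‖_F ≤ 1} min_i yᵢ f(xᵢ; Θ)` of the architecture with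
hidden widths `m`. -/
def maxMargin (φ : ℝ → ℝ) {d h n : ℕ} (m : Fin h → ℕ) (S : Sample d n) : ℝ :=
  sSup (margin φ S '' {Θ : Params d m | frobNorm Θ ≤ 1})

/-- The population 0-1 loss `Pr_{(x, y) ∼ p} [y f(x; Θ) ≤ 0]`. -/
def testError (φ : ℝ → ℝ) {d h : ℕ} {m : Fin h → ℕ}
    (p : Measure (EuclideanSpace ℝ (Fin d) × ℝ)) (Θ : Params d m) : ℝ :=
  p.real {z | z.2 * net φ Θ z.1 ≤ 0}

/-- The largest norm `C = sup_{x ∈ 𝒳} ‖x‖₂` of a point of the data domain `𝒳`. -/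
def dataRadius {d : ℕ} (X : Set (EuclideanSpace ℝ (Fin d))) : ℝ :=
  sSup ((fun x => ‖x‖) '' X)

/-- `ε(γ) = √(log log₂ (4C/γ) / n) + √(log (1/δ) / n)`. -/
def epsTerm (C δ : ℝ) (n : ℕ) (γ : ℝ) : ℝ :=
  Real.sqrt (Real.log (Real.logb 2 (4 * C / γ)) / n) + Real.sqrt (Real.log (1 / δ) / n)

end MarginNet

end

/-!
Small regularization drives the minimizers to near-maximal normalized margin, and a large normalized
margin generalizes.

*Margins.* By homogeneity of degree `q`, scaling a fixed separating network makes the data loss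
arbitrarily small at bounded cost, so the norms of the minimizers diverge as `lam → 0`
(`eventually_lt_frobNorm`). If the normalized margin of a minimizer of large norm `a` were below
half the maximal one `γ⋆`, a near-maximizer of the margin scaled to norm `a` would have a smaller
loss, because the logistic loss decays exponentially in the margin
(`eventually_half_maxMargin_le`).

*Rademacher averages.* Networks in the unit ball have Rademacher averages of order
`C / (q ^ ((q - 1) / 2) √n)`, whatever their widths. Exponential moments of the signed sums are
peeled one layer at a time (`sum_exp_norm_layer_le`): homogeneity reduces a layer to its best
normalized row, and the contraction principle for exponential moments
(`sum_iSup_exp_contraction`) removes the activation at the cost of a factor `2`. The moments of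
`‖∑ ± xᵢ‖` that remain are bounded by comparing `cosh` of the norm with a product of `cosh`
(`sum_cosh_norm_le`). The factor `2 ^ q` contributes only `√q`, and the product of the layer norms
is at most `q ^ (-q / 2)` (`normProd_mul_le`). Suprema over parameters inside sign averages are
expressed by parameters that depend on the signs.

*Generalization.* The clipped margin is a contraction of the score up to the scale `γ`, so
symmetrization (`integral_iSup_deviation_le`) and the bounded differences inequality
(`measure_bounded_differences_le`) bound its uniform deviation over finite families, hence over
a countable dense family, hence over the ball. A union bound over the scales `C / 2 ^ j` with
failure probabilities `δ / ((j + 1) (j + 2))` gives one event on which the bound holds at every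
scale (`exists_uniform_event`); the scale between `γ⋆ / 4` and `γ⋆ / 2` has index at most
`log₂ (4 C / γ⋆)`, whence the iterated logarithm.
-/

namespace MarginNet

/-! ### Averages over random signs -/

/-- The real sign `±1` encoded by a Boolean. -/
def sgn (b : Bool) : ℝ := if b then 1 else -1

@[simp] lemma sgn_not (b : Bool) : sgn (!b) = -sgn b := by cases b <;> simp [sgn]

lemma sgn_eq (b : Bool) : sgn b = 1 ∨ sgn b = -1 := by cases b <;> simp [sgn]

lemma abs_sgn (b : Bool) : |sgn b| = 1 := by cases b <;> simp [sgn]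

/-- The sign vector with its `i`-th sign reversed. -/
def flipAt {ι : Type*} [DecidableEq ι] (i : ι) (e : ι → Bool) : ι → Bool :=
  Function.update e i (!e i)

lemma flipAt_same {ι : Type*} [DecidableEq ι] (i : ι) (e : ι → Bool) :
    flipAt i e i = !e i := by simp [flipAt]

lemma flipAt_of_ne {ι : Type*} [DecidableEq ι] {i j : ι} (h : j ≠ i) (e : ι → Bool) :
    flipAt i e j = e j := by simp [flipAt, h]

lemma flipAt_involutive {ι : Type*} [DecidableEq ι] (i : ι) :
    Function.Involutive (flipAt i : (ι → Bool) → ι → Bool) := by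
  intro e
  funext j
  by_cases h : j = i
  · subst h; simp [flipAt]
  · simp [flipAt, h]

lemma sum_flipAt {ι : Type*} [Fintype ι] [DecidableEq ι] (i : ι) (F : (ι → Bool) → ℝ) :
    ∑ e, F (flipAt i e) = ∑ e, F e :=
  Equiv.sum_comp (flipAt_involutive i).toPerm F

/-- Two functions of the signs compare on average as soon as they do on each pair of sign vectors
differing in the `i`-th sign. -/
lemma sum_le_sum_of_flipAt {ι : Type*} [Fintype ι] [DecidableEq ι] (i : ι)
    (F G : (ι → Bool) → ℝ) (h : ∀ e, F e + F (flipAt i e) ≤ G e + G (flipAt i e)) :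
    ∑ e, F e ≤ ∑ e, G e := by
  have h1 := Finset.sum_le_sum (s := Finset.univ) fun e _ => h e
  rw [Finset.sum_add_distrib, Finset.sum_add_distrib, sum_flipAt, sum_flipAt] at h1
  linarith

lemma sum_not {ι : Type*} [Fintype ι] [DecidableEq ι] (F : (ι → Bool) → ℝ) :
    ∑ e : ι → Bool, F (fun i => !e i) = ∑ e, F e :=
  Equiv.sum_comp (Function.Involutive.toPerm (fun (e : ι → Bool) i => !e i)
    (fun e => by funext i; simp)) F

/-! ### The contraction principle for exponential moments -/

lemma exp_sub_exp_le {u v u' v' : ℝ} (h0 : v ≤ u) (h1 : u - v ≤ u' - v') (h2 : v ≤ v') :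
    Real.exp u - Real.exp v ≤ Real.exp u' - Real.exp v' := by
  have e1 : Real.exp u = Real.exp v * Real.exp (u - v) := by rw [← Real.exp_add]; ring_nf
  have e2 : Real.exp u' = Real.exp v' * Real.exp (u' - v') := by rw [← Real.exp_add]; ring_nf
  have a1 : Real.exp v ≤ Real.exp v' := Real.exp_le_exp.2 h2
  have a2 : Real.exp (u - v) ≤ Real.exp (u' - v') := Real.exp_le_exp.2 h1
  have a3 : 1 ≤ Real.exp (u - v) := Real.one_le_exp (by linarith)
  have a4 := Real.exp_pos v
  rw [e1, e2]
  nlinarith [mul_le_mul a1 (sub_le_sub_right a2 1) (by linarith) (by linarith)]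

/-- The two-point inequality behind the contraction principle: `p`, `r` are the values of a
contraction at `t`, `s`. The hypotheses `h1`, `h2` say that `(a, t)` is the better choice for the
first term and `(b, s)` for the second. -/
lemma exp_pair_le {a b t s p r : ℝ} (hp : |p| ≤ |t|) (hr : |r| ≤ |s|) (hpr : |p - r| ≤ |t - s|)
    (h1 : b + r ≤ a + p) (h2 : a - p ≤ b - r) :
    Real.exp (a + p) + Real.exp (b - r) ≤
      max (Real.exp (a + t) + Real.exp (b - s)) (Real.exp (b + s) + Real.exp (a - t)) := by
  have hpr0 : 0 ≤ p - r := by linarith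
  rw [abs_of_nonneg hpr0] at hpr
  have hp' := abs_le.1 hp
  have hr' := abs_le.1 hr
  rcases le_total 0 t with ht | ht <;> rcases le_total 0 s with hs | hs <;>
    simp only [abs_of_nonneg, abs_of_nonpos, ht, hs] at hp' hr'
  · rcases le_total s t with hst | hst
    · rw [abs_of_nonneg (by linarith)] at hpr
      apply le_max_of_le_left
      have := exp_sub_exp_le (u := b - r) (v := b - s) (u' := a + t) (v' := a + p)
        (by linarith) (by linarith) (by linarith)
      linarith
    · rw [abs_of_nonpos (by linarith)] at hpr
      apply le_max_of_le_right
      have := exp_sub_exp_le (u := a + p) (v := a - t) (u' := b + s) (v' := b - r)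
        (by linarith) (by linarith) (by linarith)
      linarith
  · apply le_max_of_le_left
    gcongr <;> linarith
  · apply le_max_of_le_right
    rw [add_comm (Real.exp (b + s))]
    gcongr <;> linarith
  · rcases le_total s t with hst | hst
    · rw [abs_of_nonneg (by linarith)] at hpr
      apply le_max_of_le_left
      have := exp_sub_exp_le (u := a + p) (v := a + t) (u' := b - s) (v' := b - r)
        (by linarith) (by linarith) (by linarith)
      linarith
    · rw [abs_of_nonpos (by linarith)] at hpr
      apply le_max_of_le_right
      have := exp_sub_exp_le (u := b - r) (v := b + s) (u' := a - t) (v' := a + p)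
        (by linarith) (by linarith) (by linarith)
      linarith

lemma iSup_exp_pair_le {J : Type*} [Finite J] [Nonempty J] (A t : J → ℝ) (χ : ℝ → ℝ)
    (hχ : LipschitzWith 1 χ) (h0 : χ 0 = 0) :
    (⨆ j, Real.exp (A j + χ (t j))) + (⨆ j, Real.exp (A j - χ (t j))) ≤
      (⨆ j, Real.exp (A j + t j)) + (⨆ j, Real.exp (A j - t j)) := by
  have hd : ∀ x y, |χ x - χ y| ≤ |x - y| := fun x y => by
    simpa [Real.dist_eq] using hχ.dist_le_mul x y
  have hz : ∀ x, |χ x| ≤ |x| := fun x => by simpa [h0] using hd x 0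
  obtain ⟨j, hj⟩ := exists_eq_ciSup_of_finite (f := fun j => Real.exp (A j + χ (t j)))
  obtain ⟨k, hk⟩ := exists_eq_ciSup_of_finite (f := fun j => Real.exp (A j - χ (t j)))
  have b1 : ∀ i, Real.exp (A i + χ (t i)) ≤ ⨆ j, Real.exp (A j + χ (t j)) :=
    fun i => le_ciSup (f := fun j => Real.exp (A j + χ (t j))) (Set.finite_range _).bddAbove i
  have b2 : ∀ i, Real.exp (A i - χ (t i)) ≤ ⨆ j, Real.exp (A j - χ (t j)) :=
    fun i => le_ciSup (f := fun j => Real.exp (A j - χ (t j))) (Set.finite_range _).bddAbove i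
  have c1 : ∀ i, Real.exp (A i + t i) ≤ ⨆ j, Real.exp (A j + t j) :=
    fun i => le_ciSup (f := fun j => Real.exp (A j + t j)) (Set.finite_range _).bddAbove i
  have c2 : ∀ i, Real.exp (A i - t i) ≤ ⨆ j, Real.exp (A j - t j) :=
    fun i => le_ciSup (f := fun j => Real.exp (A j - t j)) (Set.finite_range _).bddAbove i
  have d1 := b1 k
  have d2 := b2 j
  rw [← hj] at d1 ⊢
  rw [← hk] at d2 ⊢
  refine (exp_pair_le (hz (t j)) (hz (t k)) (hd _ _) (Real.exp_le_exp.1 d1)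
    (Real.exp_le_exp.1 d2)).trans (max_le ?_ ?_)
  · exact add_le_add (c1 j) (c2 k)
  · exact add_le_add (c1 k) (c2 j)

lemma sum_iSup_exp_update_le {ι J : Type*} [Fintype ι] [DecidableEq ι] [Finite J] [Nonempty J]
    (t : J → ι → ℝ) (χ : ι → ℝ → ℝ) (i : ι) (hχ : LipschitzWith 1 (χ i)) (h0 : χ i 0 = 0) :
    ∑ e : ι → Bool, (⨆ j, Real.exp (∑ l, sgn (e l) * χ l (t j l))) ≤
      ∑ e : ι → Bool, (⨆ j, Real.exp (∑ l, sgn (e l) * Function.update χ i id l (t j l))) := by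
  apply sum_le_sum_of_flipAt i
  intro e
  have hs : ∀ (f : ι → ℝ), ∑ l, sgn (e l) * f l =
      ∑ l ∈ Finset.univ.erase i, sgn (e l) * f l + sgn (e i) * f i := fun f => by
    rw [Finset.sum_erase_add _ _ (Finset.mem_univ i)]
  have hs' : ∀ (f : ι → ℝ), ∑ l, sgn (flipAt i e l) * f l =
      ∑ l ∈ Finset.univ.erase i, sgn (e l) * f l - sgn (e i) * f i := fun f => by
    rw [← Finset.sum_erase_add _ _ (Finset.mem_univ i), flipAt_same, sgn_not, sub_eq_add_neg,
      neg_mul]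
    congr 1
    refine Finset.sum_congr rfl fun l hl => ?_
    rw [flipAt_of_ne (Finset.ne_of_mem_erase hl)]
  have hu : ∀ j, ∑ l ∈ Finset.univ.erase i, sgn (e l) * Function.update χ i id l (t j l) =
      ∑ l ∈ Finset.univ.erase i, sgn (e l) * χ l (t j l) := fun j => by
    refine Finset.sum_congr rfl fun l hl => ?_
    rw [Function.update_of_ne (Finset.ne_of_mem_erase hl)]
  have key := iSup_exp_pair_le (fun j => ∑ l ∈ Finset.univ.erase i, sgn (e l) * χ l (t j l))
    (fun j => t j i) (χ i) hχ h0
  simp only [hs, hs', hu, Function.update_self, id]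
  rcases sgn_eq (e i) with h | h <;> simp only [h, one_mul, neg_one_mul, sub_neg_eq_add,
    ← sub_eq_add_neg]
  · exact key
  · rw [add_comm, add_comm (⨆ j, Real.exp (_ - t j i))]
    exact key

/-- Contraction principle: applying a contraction that vanishes at the origin to each
coordinate of a finite family of vectors does not increase the exponential moment of the maximal
signed sum. The coordinates are treated one at a time. -/
theorem sum_iSup_exp_contraction {ι J : Type*} [Fintype ι] [DecidableEq ι] [Finite J] [Nonempty J]
    (t : J → ι → ℝ) (χ : ι → ℝ → ℝ) (hχ : ∀ i, LipschitzWith 1 (χ i)) (h0 : ∀ i, χ i 0 = 0) :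
    ∑ e : ι → Bool, (⨆ j, Real.exp (∑ l, sgn (e l) * χ l (t j l))) ≤
      ∑ e : ι → Bool, (⨆ j, Real.exp (∑ l, sgn (e l) * t j l)) := by
  have key : ∀ s : Finset ι, ∑ e : ι → Bool, (⨆ j, Real.exp (∑ l, sgn (e l) * χ l (t j l))) ≤
      ∑ e : ι → Bool,
        (⨆ j, Real.exp (∑ l, sgn (e l) * (fun l => if l ∈ s then id else χ l) l (t j l))) := by
    intro s
    induction s using Finset.induction_on with
    | empty => simp
    | insert i s hi ih =>
      refine ih.trans ((sum_iSup_exp_update_le t _ i ?_ ?_).trans (le_of_eq ?_))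
      · simpa [hi] using hχ i
      · simpa [hi] using h0 i
      · have : Function.update (fun l => if l ∈ s then id else χ l) i id =
            fun l => if l ∈ insert i s then id else χ l := by
          funext l
          by_cases hl : l = i
          · subst hl; simp
          · simp [hl]
        rw [this]
  simpa using key Finset.univ

/-- The contraction principle with the maxima replaced by arbitrary choices depending on the
signs. -/
theorem exists_choice_sum_exp_contraction {ι J : Type*} [Fintype ι] [DecidableEq ι] [Finite J]
    (t : J → ι → ℝ) (χ : ι → ℝ → ℝ) (hχ : ∀ i, LipschitzWith 1 (χ i)) (h0 : ∀ i, χ i 0 = 0)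
    (σ : (ι → Bool) → J) :
    ∃ τ : (ι → Bool) → J, ∑ e : ι → Bool, Real.exp (∑ l, sgn (e l) * χ l (t (σ e) l)) ≤
      ∑ e : ι → Bool, Real.exp (∑ l, sgn (e l) * t (τ e) l) := by
  have : Nonempty J := ⟨σ fun _ => true⟩
  choose τ hτ using fun e : ι → Bool =>
    exists_eq_ciSup_of_finite (f := fun j => Real.exp (∑ l, sgn (e l) * t j l))
  refine ⟨τ, ?_⟩
  rw [Finset.sum_congr rfl fun e _ => hτ e]
  refine (Finset.sum_le_sum fun e _ => ?_).trans (sum_iSup_exp_contraction t χ hχ h0)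
  exact le_ciSup (f := fun j => Real.exp (∑ l, sgn (e l) * χ l (t j l)))
    (Set.finite_range _).bddAbove (σ e)

/-! ### Exponential moments of signed sums in a Hilbert space -/

lemma pow_add_pow_le (k : ℕ) {u v w : ℝ} (hv : |v| ≤ w) (hw : w ≤ u) :
    (u + v) ^ k + (u - v) ^ k ≤ (u + w) ^ k + (u - w) ^ k := by
  have hv' := abs_le.1 hv
  rcases eq_or_lt_of_le ((abs_nonneg v).trans hv) with h | h
  · have : v = 0 := by rw [← h] at hv; simpa using hv
    rw [this, ← h]
  have hc := (convexOn_pow (𝕜 := ℝ) k)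
  -- `u ± v` are convex combinations of `u + w` and `u - w`
  have h1 := hc.2 (show u + w ∈ Set.Ici (0 : ℝ) by simp; linarith)
    (show u - w ∈ Set.Ici (0 : ℝ) by simp; linarith)
    (show 0 ≤ (w + v) / (2 * w) from div_nonneg (by linarith) (by linarith))
    (show 0 ≤ (w - v) / (2 * w) from div_nonneg (by linarith) (by linarith))
    (by field_simp; ring)
  have h2 := hc.2 (show u + w ∈ Set.Ici (0 : ℝ) by simp; linarith)
    (show u - w ∈ Set.Ici (0 : ℝ) by simp; linarith)
    (show 0 ≤ (w - v) / (2 * w) from div_nonneg (by linarith) (by linarith))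
    (show 0 ≤ (w + v) / (2 * w) from div_nonneg (by linarith) (by linarith))
    (by field_simp; ring)
  have e1 : ((w + v) / (2 * w)) • (u + w) + ((w - v) / (2 * w)) • (u - w) = u + v := by
    simp only [smul_eq_mul]; field_simp; ring
  have e2 : ((w - v) / (2 * w)) • (u + w) + ((w + v) / (2 * w)) • (u - w) = u - v := by
    simp only [smul_eq_mul]; field_simp; ring
  rw [e1] at h1
  rw [e2] at h2
  simp only [smul_eq_mul] at h1 h2
  have e3 : (w - v) / (2 * w) = 1 - (w + v) / (2 * w) := by field_simp; ring
  rw [e3] at h1 h2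
  linarith

/-- In an inner product space the average of `cosh ‖a ± x‖` is at most the one-dimensional value,
by convexity of every term of the power series of `cosh` in the squared norm. -/
lemma cosh_norm_add_sub_le {E : Type*} [NormedAddCommGroup E] [InnerProductSpace ℝ E] (a x : E) :
    Real.cosh ‖a + x‖ + Real.cosh ‖a - x‖ ≤ 2 * (Real.cosh ‖a‖ * Real.cosh ‖x‖) := by
  have e : 2 * (Real.cosh ‖a‖ * Real.cosh ‖x‖) =
      Real.cosh (‖a‖ + ‖x‖) + Real.cosh (‖a‖ - ‖x‖) := by
    rw [Real.cosh_add, Real.cosh_sub]; ring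
  rw [e]
  refine hasSum_le (fun k => ?_) ((Real.hasSum_cosh ‖a + x‖).add (Real.hasSum_cosh ‖a - x‖))
    ((Real.hasSum_cosh (‖a‖ + ‖x‖)).add (Real.hasSum_cosh (‖a‖ - ‖x‖)))
  rw [← add_div, ← add_div]
  gcongr ?_ / _
  simp only [pow_mul]
  have h := pow_add_pow_le k (u := ‖a‖ ^ 2 + ‖x‖ ^ 2) (v := 2 * inner ℝ a x)
    (w := 2 * (‖a‖ * ‖x‖))
    (by rw [abs_mul, abs_two]; linarith [abs_real_inner_le_norm a x])
    (by nlinarith [sq_nonneg (‖a‖ - ‖x‖)])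
  have e1 : ‖a + x‖ ^ 2 = ‖a‖ ^ 2 + ‖x‖ ^ 2 + 2 * inner ℝ a x := by
    rw [norm_add_sq_real]; ring
  have e2 : ‖a - x‖ ^ 2 = ‖a‖ ^ 2 + ‖x‖ ^ 2 - 2 * inner ℝ a x := by
    rw [norm_sub_sq_real]; ring
  rw [e1, e2, add_sq', sub_sq', mul_assoc]
  exact h

lemma sum_cosh_norm_le {ι E : Type*} [Fintype ι] [DecidableEq ι] [NormedAddCommGroup E]
    [InnerProductSpace ℝ E] (x : ι → E) (s : Finset ι) :
    ∑ e : ι → Bool, Real.cosh ‖∑ i ∈ s, sgn (e i) • x i‖ ≤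
      2 ^ Fintype.card ι * ∏ i ∈ s, Real.cosh ‖x i‖ := by
  induction s using Finset.induction_on with
  | empty => simp
  | insert i s hi ih =>
    have step : ∑ e : ι → Bool, Real.cosh ‖∑ l ∈ insert i s, sgn (e l) • x l‖ ≤
        ∑ e : ι → Bool, Real.cosh ‖∑ l ∈ s, sgn (e l) • x l‖ * Real.cosh ‖x i‖ := by
      apply sum_le_sum_of_flipAt i
      intro e
      have hf : ∑ l ∈ s, sgn (flipAt i e l) • x l = ∑ l ∈ s, sgn (e l) • x l := by
        refine Finset.sum_congr rfl fun l hl => ?_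
        rw [flipAt_of_ne (by rintro rfl; exact hi hl)]
      have key := cosh_norm_add_sub_le (∑ l ∈ s, sgn (e l) • x l) (x i)
      simp only [Finset.sum_insert hi, hf, flipAt_same, sgn_not]
      rcases sgn_eq (e i) with h | h <;> simp only [h, one_smul, neg_smul, neg_neg]
      · rw [add_comm (x i), add_comm (-x i), ← sub_eq_add_neg]; linarith
      · rw [add_comm (x i), add_comm (-x i), ← sub_eq_add_neg]; linarith
    refine step.trans ?_
    rw [← Finset.sum_mul, Finset.prod_insert hi]
    calc _ ≤ (2 ^ Fintype.card ι * ∏ i ∈ s, Real.cosh ‖x i‖) * Real.cosh ‖x i‖ :=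
          mul_le_mul_of_nonneg_right ih (Real.cosh_pos _).le
      _ = _ := by ring

/-- Subgaussian bound for the norm of a signed sum of vectors of norm at most `C`. -/
theorem sum_exp_norm_le {ι E : Type*} [Fintype ι] [DecidableEq ι] [NormedAddCommGroup E]
    [InnerProductSpace ℝ E] (x : ι → E) {C : ℝ} (hx : ∀ i, ‖x i‖ ≤ C) {μ : ℝ} (hμ : 0 ≤ μ) :
    ∑ e : ι → Bool, Real.exp (μ * ‖∑ i, sgn (e i) • x i‖) ≤
      2 ^ Fintype.card ι * (2 * Real.exp (Fintype.card ι * (μ * C) ^ 2 / 2)) := by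
  have h1 : ∀ e : ι → Bool, Real.exp (μ * ‖∑ i, sgn (e i) • x i‖) ≤
      2 * Real.cosh ‖∑ i, sgn (e i) • (μ • x i)‖ := fun e => by
    have : ∑ i, sgn (e i) • (μ • x i) = μ • ∑ i, sgn (e i) • x i := by
      rw [Finset.smul_sum]
      exact Finset.sum_congr rfl fun i _ => smul_comm _ _ _
    rw [this, norm_smul, Real.norm_of_nonneg hμ, Real.cosh_eq]
    linarith [Real.exp_pos (-(μ * ‖∑ i, sgn (e i) • x i‖))]
  refine (Finset.sum_le_sum fun e _ => h1 e).trans ?_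
  rw [← Finset.mul_sum]
  have h2 := sum_cosh_norm_le (fun i => μ • x i) Finset.univ
  have h3 : ∏ i, Real.cosh ‖μ • x i‖ ≤ Real.exp (Fintype.card ι * (μ * C) ^ 2 / 2) := by
    calc ∏ i, Real.cosh ‖μ • x i‖ ≤ ∏ _i : ι, Real.exp ((μ * C) ^ 2 / 2) := by
          refine Finset.prod_le_prod (fun i _ => (Real.cosh_pos _).le) fun i _ => ?_
          refine (Real.cosh_le_exp_half_sq _).trans (Real.exp_le_exp.2 ?_)
          rw [norm_smul, Real.norm_of_nonneg hμ]
          gcongr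
          exact hx i
      _ = _ := by
          rw [Finset.prod_const, ← Real.exp_nat_mul, Finset.card_univ]
          ring_nf
  calc _ ≤ 2 * (2 ^ Fintype.card ι * ∏ i, Real.cosh ‖μ • x i‖) := by linarith
    _ ≤ 2 * (2 ^ Fintype.card ι * Real.exp (Fintype.card ι * (μ * C) ^ 2 / 2)) := by gcongr
    _ = _ := by ring

/-! ### Networks: size, homogeneity, continuity -/

/-- The Frobenius norm of a matrix. -/
noncomputable def matNorm {a b : ℕ} (W : Matrix (Fin a) (Fin b) ℝ) : ℝ :=
  Real.sqrt (∑ r, ∑ c, (W r c) ^ 2)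

lemma matNorm_nonneg {a b : ℕ} (W : Matrix (Fin a) (Fin b) ℝ) : 0 ≤ matNorm W :=
  Real.sqrt_nonneg _

lemma matNorm_sq {a b : ℕ} (W : Matrix (Fin a) (Fin b) ℝ) :
    matNorm W ^ 2 = ∑ r, ∑ c, (W r c) ^ 2 :=
  Real.sq_sqrt (Finset.sum_nonneg fun _ _ => Finset.sum_nonneg fun _ _ => sq_nonneg _)

lemma frobNorm_nonneg {d h : ℕ} {m : Fin h → ℕ} (Θ : Params d m) : 0 ≤ frobNorm Θ :=
  Real.sqrt_nonneg _

lemma frobNorm_sq {d h : ℕ} {m : Fin h → ℕ} (Θ : Params d m) :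
    frobNorm Θ ^ 2 = ∑ i, matNorm (Θ.1 i) ^ 2 + matNorm Θ.2 ^ 2 := by
  simp only [matNorm_sq]
  refine Real.sq_sqrt (add_nonneg (Finset.sum_nonneg fun _ _ => ?_) ?_) <;>
  exact Finset.sum_nonneg fun _ _ => Finset.sum_nonneg fun _ _ => sq_nonneg _

/-- The product of the Frobenius norms of all layers. -/
noncomputable def normProd {d h : ℕ} {m : Fin h → ℕ} (Θ : Params d m) : ℝ :=
  Fin.partialProd (fun i => matNorm (Θ.1 i)) (Fin.last h) * matNorm Θ.2

lemma partialProd_last {h : ℕ} (f : Fin h → ℝ) : Fin.partialProd f (Fin.last h) = ∏ i, f i := by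
  rw [Fin.partialProd, Fin.val_last, List.take_of_length_le (by simp), List.prod_ofFn]

lemma partialProd_nonneg {h : ℕ} {f : Fin h → ℝ} (hf : ∀ i, 0 ≤ f i) (k : Fin (h + 1)) :
    0 ≤ Fin.partialProd f k := by
  induction k using Fin.induction with
  | zero => simp
  | succ i ih => rw [Fin.partialProd_succ]; exact mul_nonneg ih (hf i)

/-- By the inequality of arithmetic and geometric means, the product of the norms of the `q` layers
of parameters in the unit ball is at most `q ^ (-q / 2)`. -/
lemma normProd_mul_le {d h : ℕ} {m : Fin h → ℕ} {Θ : Params d m} (hΘ : frobNorm Θ ≤ 1) :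
    normProd Θ * (((h : ℝ) + 1) ^ ((h : ℝ) / 2) * Real.sqrt ((h : ℝ) + 1)) ≤ 1 := by
  have hq : (0 : ℝ) < (h : ℝ) + 1 := by positivity
  set z : Option (Fin h) → ℝ := fun o => o.elim (matNorm Θ.2 ^ 2) fun i => matNorm (Θ.1 i) ^ 2
    with hz
  have hz0 : ∀ o, 0 ≤ z o := by rintro (_ | i) <;> simp [hz, sq_nonneg]
  have hs : ∑ o, z o = frobNorm Θ ^ 2 := by
    rw [Fintype.sum_option, frobNorm_sq, add_comm]; simp [hz]
  have hp : ∏ o, z o = normProd Θ ^ 2 := by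
    rw [Fintype.prod_option, normProd, partialProd_last, mul_pow, mul_comm, ← Finset.prod_pow]
    simp [hz]
  have hs1 : ∑ o, z o ≤ 1 := by rw [hs]; exact pow_le_one₀ (frobNorm_nonneg _) hΘ
  have am := Real.geom_mean_le_arith_mean Finset.univ (fun _ => 1) z (by simp)
    (by simp; positivity) (fun o _ => hz0 o)
  simp only [Real.rpow_one, Finset.sum_const, Finset.card_univ, Fintype.card_option,
    Fintype.card_fin, nsmul_eq_mul, mul_one, one_mul, Nat.cast_add, Nat.cast_one] at am
  have hP0 : 0 ≤ ∏ o, z o := Finset.prod_nonneg fun o _ => hz0 o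
  have h1 : ∏ o, z o ≤ (1 / ((h : ℝ) + 1)) ^ (h + 1) := by
    have h2 : (∏ o, z o) ^ (((h : ℝ) + 1)⁻¹) ≤ 1 / ((h : ℝ) + 1) :=
      am.trans (by gcongr)
    have h3 := pow_le_pow_left₀ (Real.rpow_nonneg hP0 _) h2 (h + 1)
    rwa [← Real.rpow_natCast, ← Real.rpow_mul hP0, Nat.cast_add, Nat.cast_one,
      inv_mul_cancel₀ hq.ne', Real.rpow_one] at h3
  have hD : (((h : ℝ) + 1) ^ ((h : ℝ) / 2) * Real.sqrt ((h : ℝ) + 1)) ^ 2 =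
      ((h : ℝ) + 1) ^ (h + 1) := by
    rw [mul_pow, Real.sq_sqrt hq.le, ← Real.rpow_natCast _ 2, ← Real.rpow_mul hq.le, pow_succ]
    congr 1
    rw [← Real.rpow_natCast]
    congr 1
    push_cast
    ring
  have h4 : (normProd Θ * (((h : ℝ) + 1) ^ ((h : ℝ) / 2) * Real.sqrt ((h : ℝ) + 1))) ^ 2 ≤ 1 := by
    rw [mul_pow, hD, ← hp]
    calc _ ≤ (1 / ((h : ℝ) + 1)) ^ (h + 1) * ((h : ℝ) + 1) ^ (h + 1) := by gcongr
      _ = 1 := by rw [← mul_pow, one_div_mul_cancel hq.ne', one_pow]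
  exact (abs_le_one_iff_mul_self_le_one.2 (by nlinarith) |> abs_le.1).2

lemma activation_zero {φ : ℝ → ℝ} (hh : ∀ c t : ℝ, 0 < c → φ (c * t) = c * φ t) : φ 0 = 0 := by
  have := hh 2 0 two_pos
  simp at this
  linarith

lemma activation_mul {φ : ℝ → ℝ} (hh : ∀ c t : ℝ, 0 < c → φ (c * t) = c * φ t) {c : ℝ}
    (hc : 0 ≤ c) (t : ℝ) : φ (c * t) = c * φ t := by
  rcases hc.eq_or_lt with h | h
  · simp [← h, activation_zero hh]
  · exact hh c t h

lemma abs_activation_le {φ : ℝ → ℝ} (hL : LipschitzWith 1 φ) (h0 : φ 0 = 0) (t : ℝ) :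
    |φ t| ≤ |t| := by
  simpa [Real.dist_eq, h0] using hL.dist_le_mul t 0

lemma layer_zero (φ : ℝ → ℝ) {d h : ℕ} {m : Fin h → ℕ} (Θ : Params d m)
    (x : EuclideanSpace ℝ (Fin d)) : layer φ Θ x 0 = fun j => x j := rfl

lemma layer_succ (φ : ℝ → ℝ) {d h : ℕ} {m : Fin h → ℕ} (Θ : Params d m)
    (x : EuclideanSpace ℝ (Fin d)) (i : Fin h) :
    layer φ Θ x i.succ = fun a => φ ((Θ.1 i).mulVec (layer φ Θ x i.castSucc) a) := rfl

/-- The Cauchy-Schwarz inequality, with the second norm written as a Euclidean norm. -/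
lemma abs_sum_mul_le {b : ℕ} (w z : Fin b → ℝ) :
    |∑ c, w c * z c| ≤ Real.sqrt (∑ c, w c ^ 2) * ‖WithLp.toLp 2 z‖ := by
  have h := abs_real_inner_le_norm (WithLp.toLp 2 z : EuclideanSpace ℝ (Fin b)) (WithLp.toLp 2 w)
  rw [EuclideanSpace.norm_eq (WithLp.toLp 2 w)] at h
  simp only [PiLp.inner_apply, RCLike.inner_apply, conj_trivial, Real.norm_eq_abs, sq_abs] at h
  rw [mul_comm]
  exact h

lemma norm_toLp_activation_mulVec_le {φ : ℝ → ℝ} (hφ : ∀ t, |φ t| ≤ |t|) {a b : ℕ}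
    (W : Matrix (Fin a) (Fin b) ℝ) (z : Fin b → ℝ) :
    ‖(WithLp.toLp 2 (fun r => φ (W.mulVec z r)) : EuclideanSpace ℝ (Fin a))‖ ≤
      matNorm W * ‖(WithLp.toLp 2 z : EuclideanSpace ℝ (Fin b))‖ := by
  rw [EuclideanSpace.norm_eq]
  refine Real.sqrt_le_iff.2 ⟨mul_nonneg (matNorm_nonneg _) (norm_nonneg _), ?_⟩
  rw [mul_pow, matNorm_sq, Finset.sum_mul]
  refine Finset.sum_le_sum fun r _ => ?_
  have h1 : |φ (W.mulVec z r)| ≤ Real.sqrt (∑ c, W r c ^ 2) * ‖WithLp.toLp 2 z‖ :=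
    (hφ _).trans (abs_sum_mul_le (W r) z)
  have h2 := pow_le_pow_left₀ (abs_nonneg _) h1 2
  rwa [mul_pow, Real.sq_sqrt (Finset.sum_nonneg fun _ _ => sq_nonneg _)] at h2

lemma norm_layer_le {φ : ℝ → ℝ} (hφ : ∀ t, |φ t| ≤ |t|) {d h : ℕ} {m : Fin h → ℕ}
    (Θ : Params d m) (x : EuclideanSpace ℝ (Fin d)) (k : Fin (h + 1)) :
    ‖(WithLp.toLp 2 (layer φ Θ x k) : EuclideanSpace ℝ (Fin (layerWidth d m k)))‖ ≤
      Fin.partialProd (fun i => matNorm (Θ.1 i)) k * ‖x‖ := by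
  induction k using Fin.induction with
  | zero =>
    rw [Fin.partialProd_zero, one_mul]
    exact le_rfl
  | succ i ih =>
    rw [Fin.partialProd_succ, layer_succ]
    refine (norm_toLp_activation_mulVec_le hφ _ _).trans ?_
    calc _ ≤ matNorm (Θ.1 i) * (Fin.partialProd (fun i => matNorm (Θ.1 i)) i.castSucc * ‖x‖) :=
          mul_le_mul_of_nonneg_left ih (matNorm_nonneg _)
      _ = _ := by ring

lemma net_eq_sum (φ : ℝ → ℝ) {d h : ℕ} {m : Fin h → ℕ} (Θ : Params d m)
    (x : EuclideanSpace ℝ (Fin d)) :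
    net φ Θ x = ∑ c, Θ.2 0 c * layer φ Θ x (Fin.last h) c := rfl

lemma matNorm_row {b : ℕ} (W : Matrix (Fin 1) (Fin b) ℝ) :
    matNorm W = Real.sqrt (∑ c, W 0 c ^ 2) := by
  simp [matNorm]

lemma abs_net_le {φ : ℝ → ℝ} (hφ : ∀ t, |φ t| ≤ |t|) {d h : ℕ} {m : Fin h → ℕ}
    (Θ : Params d m) (x : EuclideanSpace ℝ (Fin d)) :
    |net φ Θ x| ≤ normProd Θ * ‖x‖ := by
  rw [net_eq_sum, normProd, mul_comm (Fin.partialProd _ _), mul_assoc, matNorm_row]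
  exact (abs_sum_mul_le _ _).trans
    (mul_le_mul_of_nonneg_left (norm_layer_le hφ Θ x _) (Real.sqrt_nonneg _))

lemma layer_smul {φ : ℝ → ℝ} (hh : ∀ c t : ℝ, 0 < c → φ (c * t) = c * φ t) {d h : ℕ}
    {m : Fin h → ℕ} (Θ : Params d m) {c : ℝ} (hc : 0 ≤ c) (x : EuclideanSpace ℝ (Fin d))
    (k : Fin (h + 1)) : layer φ (c • Θ) x k = c ^ (k : ℕ) • layer φ Θ x k := by
  induction k using Fin.induction with
  | zero =>
    simp only [layer_zero, Fin.val_zero, pow_zero]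
    funext j
    exact (one_mul _).symm
  | succ i ih =>
    rw [layer_succ, layer_succ, ih]
    funext a
    have : ((c • Θ).1 i).mulVec (c ^ (i.castSucc : ℕ) • layer φ Θ x i.castSucc) a =
        c ^ (i.succ : ℕ) * (Θ.1 i).mulVec (layer φ Θ x i.castSucc) a := by
      rw [Prod.smul_fst, Pi.smul_apply, Matrix.smul_mulVec, Matrix.mulVec_smul]
      simp [pow_succ]
      ring
    rw [this, activation_mul hh (pow_nonneg hc _)]
    rfl

/-- The score is homogeneous of degree `q` in the parameters. -/
lemma net_smul {φ : ℝ → ℝ} (hh : ∀ c t : ℝ, 0 < c → φ (c * t) = c * φ t) {d h : ℕ}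
    {m : Fin h → ℕ} (Θ : Params d m) {c : ℝ} (hc : 0 ≤ c) (x : EuclideanSpace ℝ (Fin d)) :
    net φ (c • Θ) x = c ^ (h + 1) * net φ Θ x := by
  rw [net_eq_sum, net_eq_sum, layer_smul hh Θ hc, Finset.mul_sum]
  refine Finset.sum_congr rfl fun j _ => ?_
  simp [pow_succ]
  ring

lemma frobNorm_smul {d h : ℕ} {m : Fin h → ℕ} (Θ : Params d m) {c : ℝ} (hc : 0 ≤ c) :
    frobNorm (c • Θ) = c * frobNorm Θ := by
  have : frobNorm (c • Θ) ^ 2 = (c * frobNorm Θ) ^ 2 := by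
    rw [mul_pow, frobNorm_sq, frobNorm_sq]
    simp only [matNorm_sq, Prod.smul_fst, Prod.smul_snd, Pi.smul_apply, Matrix.smul_apply,
      smul_eq_mul, mul_pow, ← Finset.mul_sum, mul_add]
  exact (pow_left_inj₀ (frobNorm_nonneg _) (mul_nonneg hc (frobNorm_nonneg _)) two_ne_zero).1 this

lemma continuous_layer {φ : ℝ → ℝ} (hφ : Continuous φ) {d h : ℕ} {m : Fin h → ℕ}
    (k : Fin (h + 1)) :
    Continuous fun P : Params d m × EuclideanSpace ℝ (Fin d) => layer φ P.1 P.2 k := by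
  induction k using Fin.induction with
  | zero =>
    simp only [layer_zero]
    exact continuous_pi fun j => by fun_prop
  | succ i ih =>
    simp only [layer_succ]
    refine continuous_pi fun a => hφ.comp ?_
    have hW : Continuous fun P : Params d m × EuclideanSpace ℝ (Fin d) => P.1.1 i := by fun_prop
    exact (continuous_apply a).comp (hW.matrix_mulVec ih)

lemma continuous_net {φ : ℝ → ℝ} (hφ : Continuous φ) {d h : ℕ} {m : Fin h → ℕ} :
    Continuous fun P : Params d m × EuclideanSpace ℝ (Fin d) => net φ P.1 P.2 := by
  have hW : Continuous fun P : Params d m × EuclideanSpace ℝ (Fin d) => P.1.2 := by fun_prop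
  exact (continuous_apply (0 : Fin 1)).comp (hW.matrix_mulVec (continuous_layer hφ _))

lemma continuous_frobNorm {d h : ℕ} {m : Fin h → ℕ} :
    Continuous fun Θ : Params d m => frobNorm Θ := by
  have h1 : ∀ i a b, Continuous fun Θ : Params d m => Θ.1 i a b := fun i a b =>
    ((continuous_apply i).comp continuous_fst).matrix_elem a b
  have h2 : ∀ a b, Continuous fun Θ : Params d m => Θ.2 a b := fun a b =>
    continuous_snd.matrix_elem a b
  unfold frobNorm
  fun_prop

/-! ### Rademacher averages of networks -/

/-- Among the normalized rows of `W` one maximizes the activated signed sum, and it controls the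
Euclidean norm of the signed sum of the whole layer. -/
lemma exists_row_norm_sum_le {ι : Type*} [Fintype ι] {φ : ℝ → ℝ}
    (hh : ∀ c t : ℝ, 0 < c → φ (c * t) = c * φ t) {a b : ℕ} (W : Matrix (Fin a) (Fin b) ℝ)
    (z : ι → Fin b → ℝ) (e : ι → Bool) :
    ∃ w : Fin b → ℝ, Real.sqrt (∑ c, w c ^ 2) ≤ 1 ∧
      ‖∑ i, sgn (e i) •
        (WithLp.toLp 2 (fun r => φ (W.mulVec (z i) r)) : EuclideanSpace ℝ (Fin a))‖ ≤
      matNorm W * |∑ i, sgn (e i) * φ (∑ c, w c * z i c)| := by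
  rcases Nat.eq_zero_or_pos a with ha | ha
  · subst ha
    refine ⟨0, by simp, ?_⟩
    rw [EuclideanSpace.norm_eq]
    simpa using mul_nonneg (matNorm_nonneg W) (abs_nonneg _)
  have : Nonempty (Fin a) := ⟨⟨0, ha⟩⟩
  set ρ : Fin a → ℝ := fun r => Real.sqrt (∑ c, W r c ^ 2) with hρ
  have hρ0 : ∀ r, 0 ≤ ρ r := fun r => Real.sqrt_nonneg _
  have hρ2 : ∀ r, ρ r ^ 2 = ∑ c, W r c ^ 2 := fun r =>
    Real.sq_sqrt (Finset.sum_nonneg fun _ _ => sq_nonneg _)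
  -- for a zero row the junk value of the quotient is the zero vector, which is what is needed
  set w : Fin a → Fin b → ℝ := fun r c => W r c / ρ r with hw
  have hWw : ∀ r c, W r c = ρ r * w r c := fun r c => by
    rcases (hρ0 r).eq_or_lt with h | h
    · have h1 : ∑ c, W r c ^ 2 = 0 := by rw [← hρ2, ← h]; simp
      have h2 := (Finset.sum_eq_zero_iff_of_nonneg fun _ _ => sq_nonneg _).1 h1 c
        (Finset.mem_univ c)
      rw [← h, zero_mul]
      exact pow_eq_zero_iff two_ne_zero |>.1 h2
    · simp only [hw]; field_simp
  have hw1 : ∀ r, Real.sqrt (∑ c, w r c ^ 2) ≤ 1 := fun r => by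
    refine Real.sqrt_le_one.2 ?_
    simp only [hw, div_pow, ← Finset.sum_div, ← hρ2]
    exact div_self_le_one _
  set T : Fin a → ℝ := fun r => ∑ i, sgn (e i) * φ (∑ c, w r c * z i c) with hT
  obtain ⟨r₀, hr₀⟩ := Finite.exists_max fun r => |T r|
  refine ⟨w r₀, hw1 r₀, ?_⟩
  rw [EuclideanSpace.norm_eq]
  refine Real.sqrt_le_iff.2 ⟨mul_nonneg (matNorm_nonneg _) (abs_nonneg _), ?_⟩
  rw [mul_pow, matNorm_sq, Finset.sum_mul]
  refine Finset.sum_le_sum fun r _ => ?_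
  have h1 : (∑ i, sgn (e i) • (WithLp.toLp 2 (fun r => φ (W.mulVec (z i) r)) :
      EuclideanSpace ℝ (Fin a))) r = ρ r * T r := by
    simp only [WithLp.ofLp_sum, WithLp.ofLp_smul, Finset.sum_apply, Pi.smul_apply, smul_eq_mul, hT,
      Finset.mul_sum]
    refine Finset.sum_congr rfl fun i _ => ?_
    have : W.mulVec (z i) r = ρ r * ∑ c, w r c * z i c := by
      rw [Finset.mul_sum]
      change ∑ c, W r c * z i c = _
      refine Finset.sum_congr rfl fun c _ => ?_
      rw [← mul_assoc, ← hWw]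
    rw [this, activation_mul hh (hρ0 r)]
    ring
  rw [h1, norm_mul, mul_pow, Real.norm_of_nonneg (hρ0 r), hρ2]
  gcongr
  exact hr₀ r

lemma sum_exp_abs_le {ι : Type*} [Fintype ι] [DecidableEq ι] {J : Type*} [Finite J]
    (t : J → ι → ℝ) {φ : ℝ → ℝ} (hL : LipschitzWith 1 φ) (h0 : φ 0 = 0) (σ : (ι → Bool) → J) :
    ∃ τ : (ι → Bool) → J, ∑ e : ι → Bool, Real.exp |∑ i, sgn (e i) * φ (t (σ e) i)| ≤
      2 * ∑ e : ι → Bool, Real.exp (∑ i, sgn (e i) * t (τ e) i) := by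
  obtain ⟨τ₁, h₁⟩ := exists_choice_sum_exp_contraction t (fun _ => φ) (fun _ => hL) (fun _ => h0) σ
  obtain ⟨τ₂, h₂⟩ := exists_choice_sum_exp_contraction t (fun _ => φ) (fun _ => hL) (fun _ => h0)
    (fun e => σ fun i => !e i)
  have h3 : ∑ e : ι → Bool, Real.exp |∑ i, sgn (e i) * φ (t (σ e) i)| ≤
      ∑ e : ι → Bool, Real.exp (∑ i, sgn (e i) * φ (t (σ e) i)) +
      ∑ e : ι → Bool, Real.exp (∑ i, sgn (e i) * φ (t (σ fun i => !e i) i)) := by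
    rw [← sum_not (fun e => Real.exp (∑ i, sgn (e i) * φ (t (σ fun i => !e i) i))),
      ← Finset.sum_add_distrib]
    refine Finset.sum_le_sum fun e _ => ?_
    simp only [sgn_not, Bool.not_not, neg_mul, Finset.sum_neg_distrib]
    exact Real.exp_abs_le _
  rcases le_total (∑ e : ι → Bool, Real.exp (∑ l, sgn (e l) * t (τ₁ e) l))
    (∑ e : ι → Bool, Real.exp (∑ l, sgn (e l) * t (τ₂ e) l)) with h | h
  · exact ⟨τ₂, by linarith⟩
  · exact ⟨τ₁, by linarith⟩

/-- Peeling off the layers one at a time: each costs a factor `2`, and its norm moves into the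
scalar in front. The parameters `Θ` and the scalar `c` may depend on the signs, which stands for a
supremum over the parameters inside the average. -/
theorem sum_exp_norm_layer_le {ι : Type*} [Fintype ι] [DecidableEq ι] {φ : ℝ → ℝ}
    (hL : LipschitzWith 1 φ) (hh : ∀ c t : ℝ, 0 < c → φ (c * t) = c * φ t) {d h : ℕ}
    {m : Fin h → ℕ} (x : ι → EuclideanSpace ℝ (Fin d)) {M : ℝ} (k : Fin (h + 1)) :
    ∀ (Θ : (ι → Bool) → Params d m) (c : (ι → Bool) → ℝ), (∀ e, 0 ≤ c e) →
      (∀ e, c e * Fin.partialProd (fun i => matNorm ((Θ e).1 i)) k ≤ M) →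
      ∑ e : ι → Bool, Real.exp (c e * ‖∑ i, sgn (e i) •
        (WithLp.toLp 2 (layer φ (Θ e) (x i) k) : EuclideanSpace ℝ (Fin (layerWidth d m k)))‖) ≤
      2 ^ (k : ℕ) * ∑ e : ι → Bool, Real.exp (M * ‖∑ i, sgn (e i) • x i‖) := by
  induction k using Fin.induction with
  | zero =>
    intro Θ c hc hM
    simp only [Fin.partialProd_zero, mul_one] at hM
    simp only [Fin.val_zero, pow_zero, one_mul]
    exact Finset.sum_le_sum fun e _ =>
      Real.exp_le_exp.2 (mul_le_mul_of_nonneg_right (hM e) (norm_nonneg _))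
  | succ j ih =>
    intro Θ c hc hM
    choose w hw hwle using fun e : ι → Bool => exists_row_norm_sum_le hh ((Θ e).1 j)
      (fun i => layer φ (Θ e) (x i) j.castSucc) e
    set c' : (ι → Bool) → ℝ := fun e => c e * matNorm ((Θ e).1 j) with hc'
    have hc'0 : ∀ e, 0 ≤ c' e := fun e => mul_nonneg (hc e) (matNorm_nonneg _)
    set t : (ι → Bool) → ι → ℝ := fun e i =>
      c' e * ∑ b, w e b * layer φ (Θ e) (x i) j.castSucc b with ht
    have h1 : ∀ e, c e * ‖∑ i, sgn (e i) • (WithLp.toLp 2 (layer φ (Θ e) (x i) j.succ) :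
        EuclideanSpace ℝ (Fin (layerWidth d m j.succ)))‖ ≤ |∑ i, sgn (e i) * φ (t e i)| := by
      intro e
      calc _ ≤ c e * (matNorm ((Θ e).1 j) *
            |∑ i, sgn (e i) * φ (∑ b, w e b * layer φ (Θ e) (x i) j.castSucc b)|) :=
            mul_le_mul_of_nonneg_left (hwle e) (hc e)
        _ = |c' e * ∑ i, sgn (e i) * φ (∑ b, w e b * layer φ (Θ e) (x i) j.castSucc b)| := by
            rw [abs_mul, abs_of_nonneg (hc'0 e)]; ring
        _ = _ := by
            rw [Finset.mul_sum]
            congr 1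
            refine Finset.sum_congr rfl fun i _ => ?_
            simp only [ht]
            rw [activation_mul hh (hc'0 e)]
            ring
    obtain ⟨τ, hτ⟩ := sum_exp_abs_le t hL (activation_zero hh) id
    have h2 : ∀ e e' : ι → Bool, ∑ i, sgn (e i) * t e' i ≤ c' e' * ‖∑ i, sgn (e i) •
        (WithLp.toLp 2 (layer φ (Θ e') (x i) j.castSucc) :
          EuclideanSpace ℝ (Fin (layerWidth d m j.castSucc)))‖ := by
      intro e e'
      have e1 : ∑ i, sgn (e i) * t e' i = c' e' *
          ∑ b, w e' b * (∑ i, sgn (e i) • layer φ (Θ e') (x i) j.castSucc) b := by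
        simp only [ht, Finset.sum_apply, Pi.smul_apply, smul_eq_mul, Finset.mul_sum]
        rw [Finset.sum_comm]
        refine Finset.sum_congr rfl fun b _ => Finset.sum_congr rfl fun i _ => ?_
        ring
      rw [e1]
      refine mul_le_mul_of_nonneg_left ?_ (hc'0 e')
      refine (le_abs_self _).trans ((abs_sum_mul_le _ _).trans ?_)
      rw [WithLp.toLp_sum]
      exact mul_le_of_le_one_left (norm_nonneg _) (hw e')
    have h3 := ih (fun e => Θ (τ e)) (fun e => c' (τ e)) (fun e => hc'0 _) fun e => by
      have := hM (τ e)
      rw [Fin.partialProd_succ] at this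
      simp only [hc']
      linarith
    calc _ ≤ ∑ e : ι → Bool, Real.exp |∑ i, sgn (e i) * φ (t e i)| :=
          Finset.sum_le_sum fun e _ => Real.exp_le_exp.2 (h1 e)
      _ ≤ 2 * ∑ e : ι → Bool, Real.exp (∑ i, sgn (e i) * t (τ e) i) := hτ
      _ ≤ 2 * ∑ e : ι → Bool, Real.exp (c' (τ e) * ‖∑ i, sgn (e i) •
        (WithLp.toLp 2 (layer φ (Θ (τ e)) (x i) j.castSucc) :
          EuclideanSpace ℝ (Fin (layerWidth d m j.castSucc)))‖) := by
          gcongr with e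
          exact h2 e (τ e)
      _ ≤ 2 * (2 ^ (j.castSucc : ℕ) * ∑ e : ι → Bool, Real.exp (M * ‖∑ i, sgn (e i) • x i‖)) := by
          gcongr
      _ = _ := by
          rw [Fin.val_castSucc, Fin.val_succ, pow_succ]; ring

/-- The margin clipped to `[0, 1]` at scale `γ`: it is `0` for a non-positive margin and `1` for a
margin at least `γ`. -/
noncomputable def clip (γ t : ℝ) : ℝ := max 0 (min 1 (t / γ))

lemma clip_nonneg (γ t : ℝ) : 0 ≤ clip γ t := le_max_left _ _

lemma clip_le_one (γ t : ℝ) : clip γ t ≤ 1 := max_le zero_le_one (min_le_left _ _)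

lemma clip_zero (γ : ℝ) : clip γ 0 = 0 := by simp [clip]

lemma clip_of_nonpos {γ t : ℝ} (hγ : 0 < γ) (ht : t ≤ 0) : clip γ t = 0 :=
  max_eq_left ((min_le_right _ _).trans (div_nonpos_of_nonpos_of_nonneg ht hγ.le))

lemma clip_of_le {γ t : ℝ} (hγ : 0 < γ) (ht : γ ≤ t) : clip γ t = 1 := by
  rw [clip, min_eq_left ((one_le_div hγ).2 ht), max_eq_right zero_le_one]

lemma continuous_clip (γ : ℝ) : Continuous (clip γ) := by unfold clip; fun_prop

lemma abs_clip_sub_le {γ : ℝ} (hγ : 0 < γ) (s t : ℝ) : |clip γ s - clip γ t| ≤ |s - t| / γ := by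
  have h1 : |clip γ s - clip γ t| ≤ |s / γ - t / γ| := by
    unfold clip
    rw [max_comm 0, max_comm 0, min_comm 1, min_comm 1]
    refine (abs_max_sub_max_le_abs _ _ _).trans ?_
    have := abs_min_sub_min_le_max (s / γ) 1 (t / γ) 1
    simpa using this
  rwa [← sub_div, abs_div, abs_of_pos hγ] at h1

/-- Rademacher bound for clipped margins of networks in the unit ball. The index `σ e` of the
network may depend on the signs `e`. -/
theorem sum_sgn_mul_clip_le {φ : ℝ → ℝ} (hL : LipschitzWith 1 φ)
    (hh : ∀ c t : ℝ, 0 < c → φ (c * t) = c * φ t) {d h n : ℕ} (hn : 0 < n) {m : Fin h → ℕ}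
    {J : Type*} [Finite J] (Θ : J → Params d m) (hΘ : ∀ j, frobNorm (Θ j) ≤ 1)
    (x : Fin n → EuclideanSpace ℝ (Fin d)) {C : ℝ} (hC : 0 < C) (hx : ∀ i, ‖x i‖ ≤ C)
    (y : Fin n → ℝ) (hy : ∀ i, |y i| = 1) {γ : ℝ} (hγ : 0 < γ) (σ : (Fin n → Bool) → J) :
    ∑ e : Fin n → Bool, ∑ i, sgn (e i) * clip γ (y i * net φ (Θ (σ e)) (x i)) ≤
      2 ^ n * (n * (2 * C / (γ * ((h : ℝ) + 1) ^ ((h : ℝ) / 2) * Real.sqrt n))) := by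
  set D : ℝ := ((h : ℝ) + 1) ^ ((h : ℝ) / 2) with hD
  have hn' : (0 : ℝ) < n := by exact_mod_cast hn
  have hq : (0 : ℝ) < (h : ℝ) + 1 := by positivity
  have hD0 : 0 < D := Real.rpow_pos_of_pos hq _
  have hsn : 0 < Real.sqrt n := Real.sqrt_pos.2 hn'
  have hsq : 0 < Real.sqrt ((h : ℝ) + 1) := Real.sqrt_pos.2 hq
  -- the value of `l` balancing the two terms `q log 2` and `n (M C)² / 2` of the exponent
  set l : ℝ := γ * D * ((h : ℝ) + 1) / (C * Real.sqrt n) with hl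
  set M : ℝ := Real.sqrt ((h : ℝ) + 1) / (C * Real.sqrt n) with hMdef
  have hl0 : 0 < l := by positivity
  have hM0 : 0 < M := by positivity
  have hlM : l / γ = M * (D * Real.sqrt ((h : ℝ) + 1)) := by
    rw [hl, hMdef]
    field_simp
    rw [Real.sq_sqrt hq.le]
  have hnM : n * (M * C) ^ 2 / 2 = ((h : ℝ) + 1) / 2 := by
    rw [hMdef]
    field_simp
    rw [Real.sq_sqrt hq.le, Real.sq_sqrt hn'.le]
    ring
  set a : (Fin n → Bool) → ℝ := fun e =>
    ∑ i, sgn (e i) * clip γ (y i * net φ (Θ (σ e)) (x i)) with ha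
  obtain ⟨τ, hτ⟩ := exists_choice_sum_exp_contraction (fun j i => l / γ * net φ (Θ j) (x i))
    (fun i s => l * clip γ (y i * (γ / l * s)))
    (fun i => LipschitzWith.of_dist_le_mul fun s t => by
      rw [Real.dist_eq, Real.dist_eq, ← mul_sub, abs_mul, abs_of_pos hl0]
      calc _ ≤ l * (|y i * (γ / l * s) - y i * (γ / l * t)| / γ) :=
            mul_le_mul_of_nonneg_left (abs_clip_sub_le hγ _ _) hl0.le
        _ = ((1 : NNReal) : ℝ) * |s - t| := by
            rw [← mul_sub, ← mul_sub, abs_mul, abs_mul, hy, abs_of_pos (by positivity)]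
            push_cast
            field_simp)
    (fun i => by simp [clip_zero]) σ
  have h1 : ∑ e, Real.exp (l * a e) ≤
      ∑ e : Fin n → Bool, Real.exp (∑ i, sgn (e i) * (l / γ * net φ (Θ (τ e)) (x i))) := by
    refine (Finset.sum_le_sum fun e _ => Real.exp_le_exp.2 (le_of_eq ?_)).trans hτ
    rw [ha, Finset.mul_sum]
    refine Finset.sum_congr rfl fun i _ => ?_
    have : γ / l * (l / γ * net φ (Θ (σ e)) (x i)) = net φ (Θ (σ e)) (x i) := by field_simp
    simp only [this]
    ring
  have h2 : ∀ e : Fin n → Bool, ∑ i, sgn (e i) * (l / γ * net φ (Θ (τ e)) (x i)) ≤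
      (l / γ * matNorm (Θ (τ e)).2) * ‖∑ i, sgn (e i) •
        (WithLp.toLp 2 (layer φ (Θ (τ e)) (x i) (Fin.last h)) :
          EuclideanSpace ℝ (Fin (layerWidth d m (Fin.last h))))‖ := by
    intro e
    have e1 : ∑ i, sgn (e i) * (l / γ * net φ (Θ (τ e)) (x i)) = l / γ *
        ∑ b, (Θ (τ e)).2 0 b *
          (∑ i, sgn (e i) • layer φ (Θ (τ e)) (x i) (Fin.last h)) b := by
      simp only [net_eq_sum, Finset.sum_apply, Pi.smul_apply, smul_eq_mul, Finset.mul_sum]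
      rw [Finset.sum_comm]
      refine Finset.sum_congr rfl fun b _ => Finset.sum_congr rfl fun i _ => ?_
      ring
    rw [e1, mul_assoc]
    refine mul_le_mul_of_nonneg_left ?_ (by positivity)
    refine (le_abs_self _).trans ((abs_sum_mul_le _ _).trans ?_)
    rw [WithLp.toLp_sum, matNorm_row]
    exact le_rfl
  have h3 := sum_exp_norm_layer_le hL hh x (M := M) (Fin.last h) (fun e => Θ (τ e))
    (fun e => l / γ * matNorm (Θ (τ e)).2)
    (fun e => mul_nonneg (by positivity) (matNorm_nonneg _)) fun e => by
      have := normProd_mul_le (hΘ (τ e))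
      rw [normProd] at this
      rw [hlM]
      calc _ = M * (Fin.partialProd (fun i => matNorm ((Θ (τ e)).1 i)) (Fin.last h) *
            matNorm (Θ (τ e)).2 * (D * Real.sqrt ((h : ℝ) + 1))) := by ring
        _ ≤ M * 1 := by gcongr
        _ = M := mul_one M
  have h4 := sum_exp_norm_le x hx hM0.le
  rw [Fintype.card_fin, hnM] at h4
  have h5 : ∑ e, Real.exp (l * a e) ≤ 2 ^ n * Real.exp (2 * ((h : ℝ) + 1)) := by
    have e2 : (2 : ℝ) ≤ Real.exp 1 := by linarith [Real.add_one_le_exp 1]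
    calc _ ≤ _ := h1
      _ ≤ _ := Finset.sum_le_sum fun e _ => Real.exp_le_exp.2 (h2 e)
      _ ≤ _ := h3
      _ ≤ 2 ^ h * (2 ^ n * (2 * Real.exp (((h : ℝ) + 1) / 2))) := by
          rw [Fin.val_last]; gcongr
      _ = 2 ^ n * (2 ^ (h + 1) * Real.exp (((h : ℝ) + 1) / 2)) := by ring
      _ ≤ 2 ^ n * (Real.exp 1 ^ (h + 1) * Real.exp (((h : ℝ) + 1) / 2)) := by gcongr
      _ = 2 ^ n * Real.exp (((h : ℝ) + 1) + ((h : ℝ) + 1) / 2) := by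
          rw [← Real.exp_nat_mul, ← Real.exp_add]; push_cast; ring_nf
      _ ≤ _ := by gcongr; linarith
  have hN : (0 : ℝ) < 2 ^ n := by positivity
  -- Jensen's inequality
  have h6 := convexOn_exp.map_sum_le (t := Finset.univ) (w := fun _ : Fin n → Bool => ((2:ℝ) ^ n)⁻¹)
    (p := fun e => l * a e) (fun _ _ => by positivity) (by simp) (fun _ _ => Set.mem_univ _)
  simp only [smul_eq_mul, ← Finset.mul_sum] at h6
  have h7 : Real.exp (((2:ℝ) ^ n)⁻¹ * (l * ∑ e, a e)) ≤ Real.exp (2 * ((h : ℝ) + 1)) :=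
    h6.trans (by rw [inv_mul_le_iff₀ hN]; exact h5)
  have h8 := Real.exp_le_exp.1 h7
  rw [inv_mul_le_iff₀ hN, ← le_div_iff₀' hl0] at h8
  refine h8.trans (le_of_eq ?_)
  rw [hl]
  field_simp
  rw [Real.sq_sqrt hn'.le]

/-! ### The bounded differences inequality -/

lemma integrable_of_abs_le {α : Type*} [MeasurableSpace α] {μ : Measure α} [IsFiniteMeasure μ]
    {f : α → ℝ} (hf : Measurable f) {M : ℝ} (hM : ∀ x, |f x| ≤ M) : Integrable f μ :=
  Integrable.of_bound hf.aestronglyMeasurable M (ae_of_all _ hM)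

lemma integrable_exp_of_abs_le {α : Type*} [MeasurableSpace α] {μ : Measure α} [IsFiniteMeasure μ]
    {f : α → ℝ} (hf : Measurable f) {M : ℝ} (hM : ∀ x, |f x| ≤ M) :
    Integrable (fun x => Real.exp (f x)) μ :=
  integrable_of_abs_le hf.exp (M := Real.exp M) fun x => by
    rw [abs_of_pos (Real.exp_pos _)]
    exact Real.exp_le_exp.2 ((le_abs_self _).trans (hM x))

lemma abs_integral_le_of_abs_le {α : Type*} [MeasurableSpace α] {μ : Measure α}
    [IsProbabilityMeasure μ] {f : α → ℝ} {M : ℝ} (hM : ∀ x, |f x| ≤ M) : |∫ x, f x ∂μ| ≤ M := by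
  have := norm_integral_le_of_norm_le_const (μ := μ) (f := f) (C := M) (ae_of_all _ hM)
  simpa using this

/-- Hoeffding's lemma for a function whose oscillation is at most `c`. -/
lemma integral_exp_oscillation_le {Ω : Type*} [MeasurableSpace Ω] (p : Measure Ω)
    [IsProbabilityMeasure p] {g : Ω → ℝ} (hg : Measurable g) {c : ℝ} (hc : 0 ≤ c)
    (h : ∀ a b, |g a - g b| ≤ c) (s : ℝ) :
    ∫ a, Real.exp (s * (g a - ∫ b, g b ∂p)) ∂p ≤ Real.exp ((s * c) ^ 2 / 8) := by
  obtain ⟨a₀⟩ : Nonempty Ω := p.nonempty_of_neZero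
  have : Nonempty Ω := ⟨a₀⟩
  have hbdd : BddBelow (Set.range g) :=
    ⟨g a₀ - c, by rintro _ ⟨a, rfl⟩; linarith [(abs_le.1 (h a₀ a)).2]⟩
  have hI : ∀ a, g a ∈ Set.Icc (⨅ a, g a) ((⨅ a, g a) + c) := fun a =>
    ⟨ciInf_le hbdd a, by
      have : g a - c ≤ ⨅ a, g a := le_ciInf fun b => by linarith [(abs_le.1 (h a b)).2]
      linarith⟩
  have := (ProbabilityTheory.hasSubgaussianMGF_of_mem_Icc (μ := p) hg.aemeasurable
    (ae_of_all _ hI)).mgf_le s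
  refine (le_of_eq rfl).trans (this.trans (Real.exp_le_exp.2 (le_of_eq ?_)))
  rw [add_sub_cancel_left]
  push_cast
  rw [Real.norm_of_nonneg hc]
  ring

lemma integral_pi_succ {Ω : Type*} [MeasurableSpace Ω] (p : Measure Ω) [IsProbabilityMeasure p]
    {n : ℕ} (f : (Fin (n + 1) → Ω) → ℝ) :
    ∫ x, f x ∂(Measure.pi fun _ => p) =
      ∫ w : Ω × (Fin n → Ω), f (Fin.cons w.1 w.2) ∂(p.prod (Measure.pi fun _ => p)) := by
  have mp := measurePreserving_piFinSuccAbove (fun _ : Fin (n + 1) => p) 0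
  rw [← (mp.symm _).integral_comp' (f := (MeasurableEquiv.piFinSuccAbove (fun _ => Ω) 0).symm) f]
  refine integral_congr_ae (ae_of_all _ fun w => ?_)
  simp [MeasurableEquiv.piFinSuccAbove, Fin.insertNthEquiv]

lemma measurable_cons {Ω : Type*} [MeasurableSpace Ω] {n : ℕ} :
    Measurable fun w : Ω × (Fin n → Ω) => (Fin.cons w.1 w.2 : Fin (n + 1) → Ω) := by
  refine measurable_pi_lambda _ fun i => ?_
  refine Fin.cases ?_ (fun j => ?_) i
  · simpa using measurable_fst
  · simp only [Fin.cons_succ]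
    exact (measurable_pi_apply j).comp measurable_snd

/-- A function of independent variables that changes by at most `c` when one of them changes is
subgaussian: integrate out one variable at a time and apply Hoeffding's lemma. -/
theorem integral_exp_bounded_differences {Ω : Type*} [MeasurableSpace Ω] (p : Measure Ω)
    [IsProbabilityMeasure p] {c : ℝ} (hc : 0 ≤ c) (s M : ℝ) (n : ℕ) :
    ∀ (Z : (Fin n → Ω) → ℝ), Measurable Z → (∀ x, |Z x| ≤ M) →
      (∀ x i y, |Z (Function.update x i y) - Z x| ≤ c) →
      ∫ x, Real.exp (s * (Z x - ∫ x', Z x' ∂(Measure.pi fun _ => p))) ∂(Measure.pi fun _ => p) ≤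
        Real.exp (n * (s * c) ^ 2 / 8) := by
  induction n with
  | zero =>
    intro Z _ _ _
    have h : ∀ x, Z x = Z default := fun x => by rw [Subsingleton.elim x default]
    simp only [h]
    simp
  | succ n ih =>
    intro Z hZ hM hd
    set π : Measure (Fin n → Ω) := Measure.pi fun _ => p
    set G : Ω × (Fin n → Ω) → ℝ := fun w => Z (Fin.cons w.1 w.2) with hG
    have hGm : Measurable G := hZ.comp measurable_cons
    have hGa : ∀ a, Measurable fun x => G (a, x) := fun a =>
      hGm.comp (measurable_const.prodMk measurable_id)
    set g : Ω → ℝ := fun a => ∫ x, G (a, x) ∂π with hg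
    have hgm : Measurable g := hGm.stronglyMeasurable.integral_prod_right.measurable
    have hGi : Integrable G (p.prod π) := integrable_of_abs_le hGm fun w => hM _
    have hGai : ∀ a, Integrable (fun x => G (a, x)) π := fun a =>
      integrable_of_abs_le (hGa a) fun w => hM _
    have hgM : ∀ a, |g a| ≤ M := fun a => abs_integral_le_of_abs_le fun x => hM _
    have hgd : ∀ a b, |g a - g b| ≤ c := fun a b => by
      rw [hg]
      simp only
      rw [← integral_sub (hGai a) (hGai b)]
      refine abs_integral_le_of_abs_le fun x => ?_
      have := hd (Fin.cons b x) 0 a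
      rwa [Fin.update_cons_zero] at this
    have hE : ∫ x', Z x' ∂(Measure.pi fun _ => p) = ∫ a, g a ∂p := by
      rw [integral_pi_succ, integral_prod _ hGi]
    set E := ∫ a, g a ∂p with hEdef
    have hEM : |E| ≤ M := abs_integral_le_of_abs_le hgM
    rw [hE, integral_pi_succ]
    have hbound : ∀ u v : ℝ, |u| ≤ M → |v| ≤ M → |s * (u - v)| ≤ |s| * (2 * M) := fun u v hu hv => by
      rw [abs_mul]
      exact mul_le_mul_of_nonneg_left ((abs_sub _ _).trans (by linarith)) (abs_nonneg _)
    have hi : Integrable (fun w => Real.exp (s * (G w - E))) (p.prod π) :=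
      integrable_exp_of_abs_le ((hGm.sub_const _).const_mul _) fun w => hbound _ _ (hM _) hEM
    have hi' : Integrable (fun a => Real.exp (s * (g a - E))) p :=
      integrable_exp_of_abs_le ((hgm.sub_const _).const_mul _) fun a => hbound _ _ (hgM a) hEM
    have hinner : ∀ a, ∫ x, Real.exp (s * (G (a, x) - E)) ∂π ≤
        Real.exp (s * (g a - E)) * Real.exp (n * (s * c) ^ 2 / 8) := fun a => by
      have e1 : ∀ x, Real.exp (s * (G (a, x) - E)) =
          Real.exp (s * (g a - E)) * Real.exp (s * (G (a, x) - g a)) := fun x => by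
        rw [← Real.exp_add]; ring_nf
      simp only [e1]
      rw [integral_const_mul]
      refine mul_le_mul_of_nonneg_left ?_ (Real.exp_pos _).le
      refine ih (fun x => G (a, x)) (hGa a) (fun x => hM _) fun x i y => ?_
      have := hd (Fin.cons a x) i.succ y
      rwa [← Fin.cons_update] at this
    calc _ = ∫ a, ∫ x, Real.exp (s * (G (a, x) - E)) ∂π ∂p := integral_prod _ hi
      _ ≤ ∫ a, Real.exp (s * (g a - E)) * Real.exp (n * (s * c) ^ 2 / 8) ∂p :=
          integral_mono hi.integral_prod_left (hi'.mul_const _) hinner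
      _ = (∫ a, Real.exp (s * (g a - E)) ∂p) * Real.exp (n * (s * c) ^ 2 / 8) :=
          integral_mul_const _ _
      _ ≤ Real.exp ((s * c) ^ 2 / 8) * Real.exp (n * (s * c) ^ 2 / 8) :=
          mul_le_mul_of_nonneg_right (integral_exp_oscillation_le p hgm hc hgd s)
            (Real.exp_pos _).le
      _ = _ := by
          rw [← Real.exp_add]; push_cast; ring_nf

/-- McDiarmid's inequality, for differences at most `1`. -/
theorem measure_bounded_differences_le {Ω : Type*} [MeasurableSpace Ω] (p : Measure Ω)
    [IsProbabilityMeasure p] {n : ℕ} (hn : 0 < n) {Z : (Fin n → Ω) → ℝ} (hZ : Measurable Z) {M : ℝ}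
    (hM : ∀ x, |Z x| ≤ M) (hd : ∀ x i y, |Z (Function.update x i y) - Z x| ≤ 1) {t : ℝ}
    (ht : 0 ≤ t) :
    (Measure.pi fun _ => p).real {x | t ≤ Z x - ∫ x', Z x' ∂(Measure.pi fun _ => p)} ≤
      Real.exp (-(2 * t ^ 2 / n)) := by
  have hn' : (0 : ℝ) < n := by exact_mod_cast hn
  have hE : |∫ x', Z x' ∂(Measure.pi fun _ => p)| ≤ M := abs_integral_le_of_abs_le hM
  have h1 := ProbabilityTheory.measure_ge_le_exp_mul_mgf (μ := Measure.pi fun _ : Fin n => p)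
    (X := fun x => Z x - ∫ x', Z x' ∂(Measure.pi fun _ => p)) (t := 4 * t / n) t (by positivity)
    (integrable_exp_of_abs_le ((hZ.sub_const _).const_mul _) (M := |4 * t / n| * (2 * M)) fun x => by
      rw [abs_mul]
      exact mul_le_mul_of_nonneg_left ((abs_sub _ _).trans (by linarith [hM x])) (abs_nonneg _))
  have h2 := integral_exp_bounded_differences p zero_le_one (4 * t / n) M n Z hZ hM hd
  refine h1.trans ((mul_le_mul_of_nonneg_left h2 (Real.exp_pos _).le).trans (le_of_eq ?_))
  rw [← Real.exp_add]
  congr 1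
  field_simp
  ring

/-! ### Symmetrization -/

/-- Exchanging the `i`-th entries of two independent samples whenever the `i`-th sign is negative
preserves their joint law. -/
lemma integral_swap_signs {Ω : Type*} [MeasurableSpace Ω] (p : Measure Ω) [IsProbabilityMeasure p]
    {n : ℕ} (H : (Fin n → Ω) × (Fin n → Ω) → ℝ) (hH : Measurable H) (e : Fin n → Bool) :
    ∫ w, H w ∂((Measure.pi fun _ => p).prod (Measure.pi fun _ => p)) =
      ∫ w, H (fun i => if e i then w.1 i else w.2 i, fun i => if e i then w.2 i else w.1 i)
        ∂((Measure.pi fun _ => p).prod (Measure.pi fun _ => p)) := by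
  have mpA := measurePreserving_arrowProdEquivProdArrow Ω Ω (Fin n) (fun _ => p) (fun _ => p)
  have mpT : MeasurePreserving (fun (w : Fin n → Ω × Ω) i => if e i then w i else (w i).swap)
      (Measure.pi fun _ => p.prod p) (Measure.pi fun _ => p.prod p) := by
    refine measurePreserving_pi (fun _ => p.prod p) (fun _ => p.prod p)
      (f := fun i w => if e i then w else w.swap) fun i => ?_
    cases e i
    · simpa using Measure.measurePreserving_swap
    · exact MeasurePreserving.id _
  have hHA : Measurable fun w => H (MeasurableEquiv.arrowProdEquivProdArrow Ω Ω (Fin n) w) :=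
    hH.comp (MeasurableEquiv.measurable _)
  rw [← mpA.integral_comp' H, ← mpA.integral_comp']
  conv_lhs => rw [← mpT.map_eq]
  rw [integral_map mpT.measurable.aemeasurable hHA.aestronglyMeasurable]
  refine integral_congr_ae (ae_of_all _ fun w => ?_)
  simp only [MeasurableEquiv.arrowProdEquivProdArrow, Equiv.arrowProdEquivProdArrow]
  congr 1
  refine Prod.ext (funext fun i => ?_) (funext fun i => ?_) <;> cases h : e i <;> simp [h]

lemma ae_pi_forall {Ω : Type*} [MeasurableSpace Ω] {p : Measure Ω} [IsProbabilityMeasure p] {n : ℕ}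
    {P : Ω → Prop} (hP : ∀ᵐ z ∂p, P z) :
    ∀ᵐ S ∂(Measure.pi fun _ : Fin n => p), ∀ i, P (S i) :=
  ae_all_iff.2 fun i =>
    (measurePreserving_eval (fun _ : Fin n => p) i).quasiMeasurePreserving.ae hP

/-- Symmetrization: the expected uniform deviation over a finite class is at most twice a bound for
the Rademacher averages of the class on almost every sample. -/
theorem integral_iSup_deviation_le {Ω : Type*} [MeasurableSpace Ω] (p : Measure Ω)
    [IsProbabilityMeasure p] {n : ℕ} {J : Type*} [Finite J] [Nonempty J] (g : J → Ω → ℝ)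
    (hg : ∀ j, Measurable (g j)) (h0 : ∀ j z, 0 ≤ g j z) (h1 : ∀ j z, g j z ≤ 1) {P : Ω → Prop}
    (hP : ∀ᵐ z ∂p, P z) {R : ℝ}
    (hR : ∀ S : Fin n → Ω, (∀ i, P (S i)) → ∀ σ : (Fin n → Bool) → J,
      ∑ e : Fin n → Bool, ∑ i, sgn (e i) * g (σ e) (S i) ≤ 2 ^ n * R) :
    ∫ S : Fin n → Ω, (⨆ j, (∑ i, g j (S i) - n * ∫ z, g j z ∂p)) ∂(Measure.pi fun _ => p) ≤
      2 * R := by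
  set π : Measure (Fin n → Ω) := Measure.pi fun _ => p with hπ
  have hgabs : ∀ j z, |g j z| ≤ 1 := fun j z => abs_le.2 ⟨by linarith [h0 j z], h1 j z⟩
  have hpi : ∀ j, ∫ S : Fin n → Ω, ∑ i, g j (S i) ∂π = n * ∫ z, g j z ∂p := fun j => by
    have e1 : ∀ i : Fin n, ∫ S : Fin n → Ω, g j (S i) ∂π = ∫ z, g j z ∂p := fun i => by
      have mp := measurePreserving_eval (fun _ : Fin n => p) i
      rw [← mp.map_eq, integral_map mp.measurable.aemeasurable (hg j).aestronglyMeasurable]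
    have e2 : ∀ i : Fin n, Integrable (fun S : Fin n → Ω => g j (S i)) π := fun i =>
      integrable_of_abs_le ((hg j).comp (measurable_pi_apply i)) fun S => hgabs j _
    rw [integral_finsetSum _ fun i _ => e2 i]
    simp [e1]
  set H : (Fin n → Bool) → (Fin n → Ω) × (Fin n → Ω) → ℝ := fun e w =>
    ⨆ j, ∑ i, sgn (e i) * (g j (w.1 i) - g j (w.2 i)) with hH
  have hHm : ∀ e, Measurable (H e) := fun e => by
    refine Measurable.iSup fun j => Finset.measurable_sum _ fun i _ => ?_
    exact (((hg j).comp ((measurable_pi_apply i).comp measurable_fst)).sub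
      ((hg j).comp ((measurable_pi_apply i).comp measurable_snd))).const_mul _
  have habs : ∀ (f : J → ℝ) (B : ℝ), (∀ j, |f j| ≤ B) → |⨆ j, f j| ≤ B := fun f B hf => by
    obtain ⟨j, hj⟩ := exists_eq_ciSup_of_finite (f := f)
    rw [← hj]; exact hf j
  have hHabs : ∀ e w, |H e w| ≤ n := fun e w => by
    refine habs _ _ fun j => (Finset.abs_sum_le_sum_abs _ _).trans ?_
    refine (Finset.sum_le_card_nsmul _ _ 1 fun i _ => ?_).trans (by simp)
    rw [abs_mul, abs_sgn, one_mul, abs_le]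
    constructor <;> linarith [h0 j (w.1 i), h0 j (w.2 i), h1 j (w.1 i), h1 j (w.2 i)]
  have hHi : ∀ e, Integrable (H e) (π.prod π) := fun e => integrable_of_abs_le (hHm e) (hHabs e)
  have hZm : Measurable fun S : Fin n → Ω => ⨆ j, (∑ i, g j (S i) - n * ∫ z, g j z ∂p) := by
    refine Measurable.iSup fun j => (Finset.measurable_sum _ fun i _ => ?_).sub_const _
    exact (hg j).comp (measurable_pi_apply i)
  have hZabs : ∀ S : Fin n → Ω, |⨆ j, (∑ i, g j (S i) - n * ∫ z, g j z ∂p)| ≤ 2 * n := fun S => by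
    refine habs _ _ fun j => (abs_sub _ _).trans ?_
    have a1 : |∑ i, g j (S i)| ≤ n := (Finset.abs_sum_le_sum_abs _ _).trans
      ((Finset.sum_le_card_nsmul _ _ 1 fun i _ => hgabs j _).trans (by simp))
    have a2 : |∫ z, g j z ∂p| ≤ 1 := abs_integral_le_of_abs_le (hgabs j)
    rw [abs_mul, Nat.abs_cast]
    nlinarith [(Nat.cast_nonneg n : (0 : ℝ) ≤ n)]
  -- the expectation is replaced by the average over an independent second sample
  have hghost : ∫ S, (⨆ j, (∑ i, g j (S i) - n * ∫ z, g j z ∂p)) ∂π ≤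
      ∫ w, H (fun _ => true) w ∂(π.prod π) := by
    rw [integral_prod _ (hHi _)]
    refine integral_mono (integrable_of_abs_le hZm hZabs) (hHi _).integral_prod_left fun S => ?_
    refine ciSup_le fun j => ?_
    rw [← hpi j]
    have i1 : Integrable (fun S' : Fin n → Ω => ∑ i, g j (S' i)) π :=
      integrable_finsetSum _ fun i _ => integrable_of_abs_le
        ((hg j).comp (measurable_pi_apply i)) fun S => hgabs j _
    have e1 : ∑ i, g j (S i) - ∫ S' : Fin n → Ω, ∑ i, g j (S' i) ∂π =
        ∫ S' : Fin n → Ω, (∑ i, g j (S i) - ∑ i, g j (S' i)) ∂π := by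
      rw [integral_sub (integrable_const _) i1]; simp
    rw [e1]
    refine integral_mono ((integrable_const _).sub i1) (integrable_of_abs_le
      ((hHm _).comp (measurable_const.prodMk measurable_id)) fun S' => hHabs _ _) fun S' => ?_
    simp only [hH, sgn, if_true, one_mul, Finset.sum_sub_distrib]
    exact le_ciSup (f := fun j => ∑ i, g j (S i) - ∑ i, g j (S' i))
      (Set.finite_range _).bddAbove j
  have hswap : ∀ e, ∫ w, H (fun _ => true) w ∂(π.prod π) = ∫ w, H e w ∂(π.prod π) := fun e => by
    rw [integral_swap_signs p _ (hHm _) e]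
    refine integral_congr_ae (ae_of_all _ fun w => ?_)
    simp only [hH]
    congr 1
    funext j
    refine Finset.sum_congr rfl fun i _ => ?_
    cases h : e i <;> simp [sgn]
  have hsample : ∀ S S' : Fin n → Ω, (∀ i, P (S i)) → (∀ i, P (S' i)) →
      ∑ e, H e (S, S') ≤ 2 ^ n * (2 * R) := by
    intro S S' hS hS'
    choose σ hσ using fun e : Fin n → Bool => exists_eq_ciSup_of_finite
      (f := fun j => ∑ i, sgn (e i) * (g j (S i) - g j (S' i)))
    have e1 : ∑ e, H e (S, S') = ∑ e : Fin n → Bool, ∑ i, sgn (e i) * g (σ e) (S i) +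
        ∑ e : Fin n → Bool, ∑ i, sgn (e i) * g (σ fun i => !e i) (S' i) := by
      rw [← sum_not fun e : Fin n → Bool => ∑ i, sgn (e i) * g (σ fun i => !e i) (S' i),
        ← Finset.sum_add_distrib]
      refine Finset.sum_congr rfl fun e _ => ?_
      simp only [hH]
      rw [← hσ e, ← Finset.sum_add_distrib]
      refine Finset.sum_congr rfl fun i _ => ?_
      simp only [sgn_not, Bool.not_not]
      ring
    rw [e1]
    have := hR S hS σ
    have := hR S' hS' fun e => σ fun i => !e i
    linarith
  have hae : ∀ᵐ w ∂(π.prod π), ∑ e, H e w ≤ 2 ^ n * (2 * R) := by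
    have a1 : ∀ᵐ w ∂(π.prod π), ∀ i, P (w.1 i) :=
      Measure.quasiMeasurePreserving_fst.ae (ae_pi_forall hP)
    have a2 : ∀ᵐ w ∂(π.prod π), ∀ i, P (w.2 i) :=
      Measure.quasiMeasurePreserving_snd.ae (ae_pi_forall hP)
    filter_upwards [a1, a2] with w hw1 hw2 using hsample w.1 w.2 hw1 hw2
  have htotal : (2 : ℝ) ^ n * ∫ w, H (fun _ => true) w ∂(π.prod π) ≤ 2 ^ n * (2 * R) := by
    calc _ = ∑ e : Fin n → Bool, ∫ w, H e w ∂(π.prod π) := by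
          rw [← Finset.sum_congr rfl fun e _ => hswap e]; simp
      _ = ∫ w, ∑ e : Fin n → Bool, H e w ∂(π.prod π) := (integral_finsetSum _ fun e _ => hHi e).symm
      _ ≤ ∫ _w, 2 ^ n * (2 * R) ∂(π.prod π) :=
          integral_mono_ae (integrable_finsetSum _ fun e _ => hHi e) (integrable_const _) hae
      _ = _ := by simp
  exact hghost.trans (le_of_mul_le_mul_left htotal (by positivity))

/-- Uniform deviation bound over a finite class of functions with values in `[0, 1]`. -/
theorem measure_exists_deviation_le {Ω : Type*} [MeasurableSpace Ω] (p : Measure Ω)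
    [IsProbabilityMeasure p] {n : ℕ} (hn : 0 < n) {J : Type*} [Finite J] [Nonempty J]
    (g : J → Ω → ℝ) (hg : ∀ j, Measurable (g j)) (h0 : ∀ j z, 0 ≤ g j z) (h1 : ∀ j z, g j z ≤ 1)
    {P : Ω → Prop} (hP : ∀ᵐ z ∂p, P z) {R : ℝ}
    (hR : ∀ S : Fin n → Ω, (∀ i, P (S i)) → ∀ σ : (Fin n → Bool) → J,
      ∑ e : Fin n → Bool, ∑ i, sgn (e i) * g (σ e) (S i) ≤ 2 ^ n * R) {t : ℝ} (ht : 0 ≤ t) :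
    (Measure.pi fun _ => p).real
      {S : Fin n → Ω | ∃ j, 2 * R + t < ∑ i, g j (S i) - n * ∫ z, g j z ∂p} ≤
      Real.exp (-(2 * t ^ 2 / n)) := by
  set Z : (Fin n → Ω) → ℝ := fun S => ⨆ j, (∑ i, g j (S i) - n * ∫ z, g j z ∂p) with hZ
  have hle : ∀ S j, ∑ i, g j (S i) - n * ∫ z, g j z ∂p ≤ Z S := fun S j =>
    le_ciSup (f := fun j => ∑ i, g j (S i) - n * ∫ z, g j z ∂p) (Set.finite_range _).bddAbove j
  have hZm : Measurable Z := by
    refine Measurable.iSup fun j => (Finset.measurable_sum _ fun i _ => ?_).sub_const _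
    exact (hg j).comp (measurable_pi_apply i)
  have hZabs : ∀ S, |Z S| ≤ n := fun S => by
    obtain ⟨j, hj⟩ := exists_eq_ciSup_of_finite
      (f := fun j => ∑ i, g j (S i) - n * ∫ z, g j z ∂p)
    simp only [hZ]
    rw [← hj, abs_le]
    have a1 : 0 ≤ ∑ i, g j (S i) := Finset.sum_nonneg fun i _ => h0 j _
    have a2 : ∑ i, g j (S i) ≤ n :=
      (Finset.sum_le_card_nsmul _ _ 1 fun i _ => h1 j _).trans (by simp)
    have a3 : 0 ≤ ∫ z, g j z ∂p := integral_nonneg (h0 j)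
    have a4 : ∫ z, g j z ∂p ≤ 1 := (le_abs_self _).trans
      (abs_integral_le_of_abs_le fun z => by rw [abs_of_nonneg (h0 j z)]; exact h1 j z)
    constructor <;> nlinarith [(Nat.cast_nonneg n : (0 : ℝ) ≤ n)]
  have hone : ∀ S i y, Z (Function.update S i y) ≤ Z S + 1 := fun S i y => by
    refine ciSup_le fun j => ?_
    have e1 : ∑ l, g j (Function.update S i y l) ≤ ∑ l, g j (S l) + 1 := by
      rw [← Finset.add_sum_erase _ _ (Finset.mem_univ i),
        ← Finset.add_sum_erase _ (fun l => g j (S l)) (Finset.mem_univ i)]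
      have : ∑ l ∈ Finset.univ.erase i, g j (Function.update S i y l) =
          ∑ l ∈ Finset.univ.erase i, g j (S l) := Finset.sum_congr rfl fun l hl => by
        rw [Function.update_of_ne (Finset.ne_of_mem_erase hl)]
      rw [this, Function.update_self]
      linarith [h1 j y, h0 j (S i)]
    linarith [hle S j]
  have hd : ∀ S i y, |Z (Function.update S i y) - Z S| ≤ 1 := fun S i y => by
    have b1 := hone S i y
    have b2 := hone (Function.update S i y) i (S i)
    rw [Function.update_idem, Function.update_eq_self] at b2
    rw [abs_le]
    constructor <;> linarith
  have hE := integral_iSup_deviation_le p g hg h0 h1 hP hR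
  refine (measureReal_mono ?_).trans (measure_bounded_differences_le p hn hZm hZabs hd ht)
  rintro S ⟨j, hj⟩
  have := hle S j
  change t ≤ Z S - _
  linarith

/-! ### The regularized loss: minimizers and their margins -/

lemma matNorm_le_frobNorm {d h : ℕ} {m : Fin h → ℕ} (Θ : Params d m) (i : Fin h) :
    matNorm (Θ.1 i) ≤ frobNorm Θ := by
  refine le_of_sq_le_sq ?_ (frobNorm_nonneg _)
  rw [frobNorm_sq]
  have := Finset.single_le_sum (f := fun i => matNorm (Θ.1 i) ^ 2) (fun i _ => sq_nonneg _)
    (Finset.mem_univ i)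
  linarith [sq_nonneg (matNorm Θ.2)]

lemma matNorm_output_le_frobNorm {d h : ℕ} {m : Fin h → ℕ} (Θ : Params d m) :
    matNorm Θ.2 ≤ frobNorm Θ := by
  refine le_of_sq_le_sq ?_ (frobNorm_nonneg _)
  rw [frobNorm_sq]
  linarith [Finset.sum_nonneg fun (i : Fin h) (_ : i ∈ Finset.univ) => sq_nonneg (matNorm (Θ.1 i))]

lemma abs_entry_le_matNorm {a b : ℕ} (W : Matrix (Fin a) (Fin b) ℝ) (r : Fin a) (c : Fin b) :
    |W r c| ≤ matNorm W := by
  refine Real.le_sqrt_of_sq_le ?_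
  rw [sq_abs]
  exact (Finset.single_le_sum (f := fun c => W r c ^ 2) (fun _ _ => sq_nonneg _)
    (Finset.mem_univ c)).trans (Finset.single_le_sum (f := fun r => ∑ c, W r c ^ 2)
    (fun _ _ => Finset.sum_nonneg fun _ _ => sq_nonneg _) (Finset.mem_univ r))

lemma isCompact_matrix_Icc (a b : ℕ) (R : ℝ) :
    IsCompact {W : Matrix (Fin a) (Fin b) ℝ | ∀ r c, W r c ∈ Set.Icc (-R) R} := by
  have hK : IsCompact (X := Matrix (Fin a) (Fin b) ℝ)
      (Set.univ.pi fun _ : Fin a => Set.univ.pi fun _ : Fin b => Set.Icc (-R) R) :=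
    isCompact_univ_pi fun _ => isCompact_univ_pi fun _ => isCompact_Icc
  have e : {W : Matrix (Fin a) (Fin b) ℝ | ∀ r c, W r c ∈ Set.Icc (-R) R} =
      Set.univ.pi fun _ : Fin a => Set.univ.pi fun _ : Fin b => Set.Icc (-R) R :=
    Set.ext fun W => ⟨fun h r _ c _ => h r c, fun h r c => h r trivial c trivial⟩
  rw [e]
  exact hK

lemma isCompact_frobNorm_le {d h : ℕ} {m : Fin h → ℕ} (R : ℝ) :
    IsCompact {Θ : Params d m | frobNorm Θ ≤ R} := by
  have hK := (isCompact_univ_pi fun i : Fin h => isCompact_matrix_Icc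
    (layerWidth d m i.succ) (layerWidth d m i.castSucc) R).prod
    (isCompact_matrix_Icc 1 (layerWidth d m (Fin.last h)) R)
  refine hK.of_isClosed_subset (isClosed_le continuous_frobNorm continuous_const) ?_
  intro Θ hΘ
  refine ⟨fun i _ r c => ?_, fun r c => ?_⟩
  · exact abs_le.1 ((abs_entry_le_matNorm _ r c).trans ((matNorm_le_frobNorm Θ i).trans hΘ))
  · exact abs_le.1 ((abs_entry_le_matNorm _ r c).trans ((matNorm_output_le_frobNorm Θ).trans hΘ))

/-- The average logistic loss on the sample, without the regularizer. -/
noncomputable def dataLoss (φ : ℝ → ℝ) {d h n : ℕ} {m : Fin h → ℕ} (S : Sample d n)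
    (Θ : Params d m) : ℝ :=
  (1 / (n : ℝ)) * ∑ i, Real.log (1 + Real.exp (-((S i).2 * net φ Θ (S i).1)))

lemma regLoss_eq (φ : ℝ → ℝ) {d h n : ℕ} {m : Fin h → ℕ} (S : Sample d n) (lam : ℝ)
    (Θ : Params d m) : regLoss φ S lam Θ = dataLoss φ S Θ + lam * frobNorm Θ ^ 2 := rfl

lemma logistic_pos (v : ℝ) : 0 < Real.log (1 + Real.exp (-v)) :=
  Real.log_pos (by linarith [Real.exp_pos (-v)])

lemma logistic_le_of_le {u v : ℝ} (h : u ≤ v) :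
    Real.log (1 + Real.exp (-v)) ≤ Real.log (1 + Real.exp (-u)) := by
  refine Real.log_le_log (by positivity) ?_
  gcongr

lemma logistic_le_exp (v : ℝ) : Real.log (1 + Real.exp (-v)) ≤ Real.exp (-v) := by
  have := Real.log_le_sub_one_of_pos (show 0 < 1 + Real.exp (-v) by positivity)
  linarith

lemma half_exp_le_logistic {v : ℝ} (hv : 0 ≤ v) :
    Real.exp (-v) / 2 ≤ Real.log (1 + Real.exp (-v)) := by
  have h1 : Real.exp (-v) ≤ 1 := Real.exp_le_one_iff.2 (by linarith)
  have h0 := Real.exp_pos (-v)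
  refine le_trans ?_ (Real.one_sub_inv_le_log_of_pos (show 0 < 1 + Real.exp (-v) by positivity))
  have : 1 - (1 + Real.exp (-v))⁻¹ = Real.exp (-v) / (1 + Real.exp (-v)) := by field_simp; ring
  rw [this]
  gcongr
  linarith

lemma continuous_net_left {φ : ℝ → ℝ} (hφ : Continuous φ) {d h : ℕ} {m : Fin h → ℕ}
    (x : EuclideanSpace ℝ (Fin d)) : Continuous fun Θ : Params d m => net φ Θ x :=
  (continuous_net hφ).comp (continuous_id.prodMk continuous_const)

lemma continuous_dataLoss {φ : ℝ → ℝ} (hφ : Continuous φ) {d h n : ℕ} {m : Fin h → ℕ}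
    (S : Sample d n) : Continuous fun Θ : Params d m => dataLoss φ S Θ := by
  refine continuous_const.mul (continuous_finsetSum _ fun i _ => ?_)
  refine Continuous.log ?_ fun Θ => by positivity
  exact continuous_const.add
    (Real.continuous_exp.comp (continuous_const.mul (continuous_net_left hφ _)).neg)

lemma dataLoss_nonneg (φ : ℝ → ℝ) {d h n : ℕ} {m : Fin h → ℕ} (S : Sample d n)
    (Θ : Params d m) : 0 ≤ dataLoss φ S Θ :=
  mul_nonneg (by positivity) (Finset.sum_nonneg fun _ _ => (logistic_pos _).le)

lemma dataLoss_pos (φ : ℝ → ℝ) {d h n : ℕ} (hn : 0 < n) {m : Fin h → ℕ} (S : Sample d n)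
    (Θ : Params d m) : 0 < dataLoss φ S Θ :=
  mul_pos (by positivity) (Finset.sum_pos (fun _ _ => logistic_pos _) ⟨⟨0, hn⟩, Finset.mem_univ _⟩)

lemma dataLoss_le_exp {φ : ℝ → ℝ} {d h n : ℕ} (hn : 0 < n) {m : Fin h → ℕ} {S : Sample d n}
    {Θ : Params d m} {v : ℝ} (hv : ∀ i, v ≤ (S i).2 * net φ Θ (S i).1) :
    dataLoss φ S Θ ≤ Real.exp (-v) := by
  have hn' : (0 : ℝ) < n := by exact_mod_cast hn
  calc dataLoss φ S Θ ≤ (1 / (n : ℝ)) * ∑ _i : Fin n, Real.exp (-v) := by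
        refine mul_le_mul_of_nonneg_left (Finset.sum_le_sum fun i _ => ?_) (by positivity)
        exact (logistic_le_of_le (hv i)).trans (logistic_le_exp v)
    _ = Real.exp (-v) := by
        simp only [Finset.sum_const, Finset.card_univ, Fintype.card_fin, nsmul_eq_mul]
        field_simp

lemma frobNorm_zero {d h : ℕ} {m : Fin h → ℕ} : frobNorm (0 : Params d m) = 0 := by
  simp [frobNorm]

/-- The regularizer makes the loss coercive, so a minimizer exists by compactness of balls. -/
theorem exists_isMinOn_regLoss {φ : ℝ → ℝ} (hφ : Continuous φ) {d h n : ℕ} {m : Fin h → ℕ}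
    (S : Sample d n) {lam : ℝ} (hl : 0 < lam) :
    ∃ Θ : Params d m, IsMinOn (regLoss φ S lam) Set.univ Θ := by
  set R : ℝ := Real.sqrt (regLoss φ S lam (0 : Params d m) / lam) with hR
  have hF0 : 0 ≤ regLoss φ S lam (0 : Params d m) := by
    rw [regLoss_eq]
    have := dataLoss_nonneg φ S (0 : Params d m)
    positivity
  have hcont : Continuous fun Θ : Params d m => regLoss φ S lam Θ :=
    (continuous_dataLoss hφ S).add (continuous_const.mul (continuous_frobNorm.pow 2))
  obtain ⟨Θ, hΘ, hmin⟩ := (isCompact_frobNorm_le (d := d) (m := m) R).exists_isMinOn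
    ⟨0, by rw [Set.mem_ofPred_eq, frobNorm_zero]; exact Real.sqrt_nonneg _⟩ hcont.continuousOn
  refine ⟨Θ, fun Θ' _ => ?_⟩
  by_cases h : frobNorm Θ' ≤ R
  · exact hmin h
  · have h0 : regLoss φ S lam Θ ≤ regLoss φ S lam (0 : Params d m) :=
      hmin (by rw [Set.mem_ofPred_eq, frobNorm_zero]; exact Real.sqrt_nonneg _)
    have h1 : regLoss φ S lam (0 : Params d m) ≤ lam * frobNorm Θ' ^ 2 := by
      have : R ^ 2 ≤ frobNorm Θ' ^ 2 := pow_le_pow_left₀ (Real.sqrt_nonneg _) (not_le.1 h).le 2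
      rw [hR, Real.sq_sqrt (div_nonneg hF0 hl.le), div_le_iff₀ hl] at this
      linarith
    refine h0.trans (h1.trans ?_)
    rw [regLoss_eq]
    linarith [dataLoss_nonneg φ S Θ']

lemma margin_le {φ : ℝ → ℝ} {d h n : ℕ} {m : Fin h → ℕ} (S : Sample d n) (Θ : Params d m)
    (i : Fin n) : margin φ S Θ ≤ (S i).2 * net φ Θ (S i).1 :=
  ciInf_le (f := fun i => (S i).2 * net φ Θ (S i).1) (Set.finite_range _).bddBelow i

lemma margin_le_of_norm_le {φ : ℝ → ℝ} (hφ : ∀ t, |φ t| ≤ |t|) {d h n : ℕ} (hn : 0 < n)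
    {m : Fin h → ℕ} {S : Sample d n} {C : ℝ} (hS : ∀ i, |(S i).2| * ‖(S i).1‖ ≤ C)
    {Θ : Params d m} (hΘ : frobNorm Θ ≤ 1) :
    margin φ S Θ ≤ C / (((h : ℝ) + 1) ^ ((h : ℝ) / 2) * Real.sqrt ((h : ℝ) + 1)) := by
  have hD : 0 < ((h : ℝ) + 1) ^ ((h : ℝ) / 2) * Real.sqrt ((h : ℝ) + 1) := by positivity
  have hC : 0 ≤ C := (mul_nonneg (abs_nonneg _) (norm_nonneg _)).trans (hS ⟨0, hn⟩)
  refine (margin_le S Θ ⟨0, hn⟩).trans ((le_abs_self _).trans ?_)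
  rw [abs_mul]
  calc _ ≤ |(S ⟨0, hn⟩).2| * (normProd Θ * ‖(S ⟨0, hn⟩).1‖) :=
        mul_le_mul_of_nonneg_left (abs_net_le hφ _ _) (abs_nonneg _)
    _ = normProd Θ * (|(S ⟨0, hn⟩).2| * ‖(S ⟨0, hn⟩).1‖) := by ring
    _ ≤ normProd Θ * C := mul_le_mul_of_nonneg_left (hS _)
        (mul_nonneg (partialProd_nonneg (fun _ => matNorm_nonneg _) _) (matNorm_nonneg _))
    _ ≤ _ := by
        rw [le_div_iff₀ hD]
        nlinarith [normProd_mul_le hΘ]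

lemma nonempty_margin {φ : ℝ → ℝ} {d h n : ℕ} {m : Fin h → ℕ} (S : Sample d n) :
    (margin φ S '' {Θ : Params d m | frobNorm Θ ≤ 1}).Nonempty :=
  ⟨_, 0, by rw [Set.mem_ofPred_eq, frobNorm_zero]; exact zero_le_one, rfl⟩

lemma maxMargin_le {φ : ℝ → ℝ} (hφ : ∀ t, |φ t| ≤ |t|) {d h n : ℕ} (hh : 1 ≤ h) (hn : 0 < n)
    {m : Fin h → ℕ} {S : Sample d n} {C : ℝ} (hS : ∀ i, |(S i).2| * ‖(S i).1‖ ≤ C) :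
    maxMargin φ m S ≤ C / 2 := by
  have hC : 0 ≤ C := (mul_nonneg (abs_nonneg _) (norm_nonneg _)).trans (hS ⟨0, hn⟩)
  refine csSup_le (nonempty_margin S) ?_
  rintro _ ⟨Θ, hΘ, rfl⟩
  refine (margin_le_of_norm_le hφ hn hS hΘ).trans ?_
  have hh' : (1 : ℝ) ≤ h := by exact_mod_cast hh
  have h1 : Real.sqrt 2 ≤ ((h : ℝ) + 1) ^ ((h : ℝ) / 2) := by
    rw [Real.sqrt_eq_rpow]
    calc (2 : ℝ) ^ (1 / 2 : ℝ) ≤ ((h : ℝ) + 1) ^ (1 / 2 : ℝ) :=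
          Real.rpow_le_rpow (by norm_num) (by linarith) (by norm_num)
      _ ≤ _ := Real.rpow_le_rpow_of_exponent_le (by linarith) (by linarith)
  have h2 : Real.sqrt 2 ≤ Real.sqrt ((h : ℝ) + 1) := Real.sqrt_le_sqrt (by linarith)
  gcongr
  calc (2 : ℝ) = Real.sqrt 2 * Real.sqrt 2 := (Real.mul_self_sqrt (by norm_num)).symm
    _ ≤ _ := by gcongr

/-- As the regularization vanishes the norm of the minimizers exceeds every bound: on a ball the
data loss is bounded below, while it can be made small at a bounded cost. -/
lemma eventually_lt_frobNorm {φ : ℝ → ℝ} (hφ : Continuous φ)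
    (hh : ∀ c t : ℝ, 0 < c → φ (c * t) = c * φ t) {d h n : ℕ} (hn : 0 < n) {m : Fin h → ℕ}
    {S : Sample d n} {Θs : Params d m} (hΘs : frobNorm Θs ≤ 1) {g : ℝ} (hg : 0 < g)
    (hm : ∀ i, g ≤ (S i).2 * net φ Θs (S i).1) {Θ : ℝ → Params d m}
    (hΘ : ∀ lam : ℝ, 0 < lam → IsMinOn (regLoss φ S lam) Set.univ (Θ lam)) {R : ℝ} (hR : 0 ≤ R) :
    ∀ᶠ lam in 𝓝[>] (0 : ℝ), R < frobNorm (Θ lam) := by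
  obtain ⟨Θ₀, -, hmin⟩ := (isCompact_frobNorm_le (d := d) (m := m) R).exists_isMinOn
    ⟨0, by rw [Set.mem_ofPred_eq, frobNorm_zero]; exact hR⟩ (continuous_dataLoss hφ S).continuousOn
  set ε := dataLoss φ S Θ₀ with hε
  have hε0 : 0 < ε := dataLoss_pos φ hn S Θ₀
  obtain ⟨b, hb1, hb⟩ : ∃ b : ℝ, 1 ≤ b ∧ Real.exp (-(b * g)) < ε / 2 := by
    have : Tendsto (fun b : ℝ => Real.exp (-(b * g))) atTop (𝓝 0) :=
      Real.tendsto_exp_neg_atTop_nhds_zero.comp (tendsto_id.atTop_mul_const hg)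
    obtain ⟨b, hb⟩ := ((this.eventually_lt_const (half_pos hε0)).and (eventually_ge_atTop 1)).exists
    exact ⟨b, hb.2, hb.1⟩
  have hsmall : ∀ᶠ lam in 𝓝[>] (0 : ℝ), lam < ε / (2 * b ^ 2) :=
    mem_nhdsWithin_of_mem_nhds (Iio_mem_nhds (by positivity))
  filter_upwards [hsmall, self_mem_nhdsWithin] with lam hlam hpos
  replace hpos : 0 < lam := hpos
  by_contra hle
  have h1 : ε ≤ dataLoss φ S (Θ lam) := hmin (not_lt.1 hle)
  have h2 : regLoss φ S lam (Θ lam) ≤ regLoss φ S lam (b • Θs) := hΘ lam hpos (Set.mem_univ _)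
  have hb0 : 0 ≤ b := by linarith
  have h3 : dataLoss φ S (b • Θs) ≤ Real.exp (-(b * g)) := by
    refine dataLoss_le_exp hn fun i => ?_
    rw [net_smul hh _ hb0]
    have hbp : b ≤ b ^ (h + 1) := le_self_pow₀ hb1 (by omega)
    nlinarith [hm i, mul_le_mul hbp (hm i) hg.le (by positivity)]
  have h4 : frobNorm (b • Θs) ^ 2 ≤ b ^ 2 := by
    rw [frobNorm_smul _ hb0]
    exact pow_le_pow_left₀ (mul_nonneg hb0 (frobNorm_nonneg _)) (mul_le_of_le_one_right hb0 hΘs) 2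
  have h5 : lam * b ^ 2 < ε / 2 := by
    rw [lt_div_iff₀ (by positivity)] at hlam
    linarith
  rw [regLoss_eq, regLoss_eq] at h2
  have h6 : lam * frobNorm (b • Θs) ^ 2 ≤ lam * b ^ 2 := mul_le_mul_of_nonneg_left h4 hpos.le
  have h7 : 0 ≤ lam * frobNorm (Θ lam) ^ 2 := by positivity
  linarith

/-- For small regularization the normalized margin of a minimizer is at least half of the maximal
one: otherwise rescaling a near-maximizer of the margin to the norm of the minimizer would lower
the loss, since the logistic loss decays exponentially in the margin and the norms diverge. -/
theorem eventually_half_maxMargin_le {φ : ℝ → ℝ} (hφ : Continuous φ)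
    (hh : ∀ c t : ℝ, 0 < c → φ (c * t) = c * φ t) {d h n : ℕ} (hn : 0 < n) {m : Fin h → ℕ}
    {S : Sample d n} (hγ : 0 < maxMargin φ m S) {Θ : ℝ → Params d m}
    (hΘ : ∀ lam : ℝ, 0 < lam → IsMinOn (regLoss φ S lam) Set.univ (Θ lam)) :
    ∀ᶠ lam in 𝓝[>] (0 : ℝ), 0 < frobNorm (Θ lam) ∧
      ∀ i, maxMargin φ m S / 2 * frobNorm (Θ lam) ^ (h + 1) ≤
        (S i).2 * net φ (Θ lam) (S i).1 := by
  set γ := maxMargin φ m S with hγdef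
  have hn' : (0 : ℝ) < n := by exact_mod_cast hn
  obtain ⟨_, ⟨Θs, hΘs, rfl⟩, hms⟩ := exists_lt_of_lt_csSup (nonempty_margin (φ := φ) (m := m) S)
    (show 3 / 4 * γ < maxMargin φ m S by linarith)
  have hm : ∀ i, 3 / 4 * γ ≤ (S i).2 * net φ Θs (S i).1 := fun i => hms.le.trans (margin_le S Θs i)
  have hg : 0 < 3 / 4 * γ := by linarith
  filter_upwards [eventually_lt_frobNorm hφ hh hn hΘs hg hm hΘ
    (R := max 1 (4 * Real.log (2 * n) / γ)) (by positivity), self_mem_nhdsWithin] with lam hlam hpos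
  replace hpos : 0 < lam := hpos
  set a := frobNorm (Θ lam) with ha
  have ha1 : 1 < a := (le_max_left _ _).trans_lt hlam
  have ha2 : 4 * Real.log (2 * n) / γ < a := (le_max_right _ _).trans_lt hlam
  have ha0 : 0 ≤ a := by linarith
  refine ⟨by linarith, fun i => ?_⟩
  by_contra hlt
  rw [not_le] at hlt
  set A := a ^ (h + 1) with hA
  have haA : a ≤ A := le_self_pow₀ ha1.le (by omega)
  have hA0 : 0 < A := by linarith
  have h1 : regLoss φ S lam (Θ lam) ≤ regLoss φ S lam (a • Θs) := hΘ lam hpos (Set.mem_univ _)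
  have h2 : frobNorm (a • Θs) ≤ a := by
    rw [frobNorm_smul _ ha0]; exact mul_le_of_le_one_right ha0 hΘs
  have h3 : dataLoss φ S (Θ lam) ≤ dataLoss φ S (a • Θs) := by
    rw [regLoss_eq, regLoss_eq] at h1
    have : lam * frobNorm (a • Θs) ^ 2 ≤ lam * a ^ 2 :=
      mul_le_mul_of_nonneg_left (pow_le_pow_left₀ (frobNorm_nonneg _) h2 2) hpos.le
    linarith
  have h4 : dataLoss φ S (a • Θs) ≤ Real.exp (-(A * (3 / 4 * γ))) := by
    refine dataLoss_le_exp hn fun i => ?_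
    rw [net_smul hh _ ha0]
    nlinarith [mul_le_mul_of_nonneg_left (hm i) hA0.le]
  have h5 : 1 / (n : ℝ) * (Real.exp (-(γ / 2 * A)) / 2) ≤ dataLoss φ S (Θ lam) := by
    refine mul_le_mul_of_nonneg_left ?_ (by positivity)
    refine (half_exp_le_logistic (by positivity)).trans ((logistic_le_of_le hlt.le).trans ?_)
    exact Finset.single_le_sum
      (f := fun i => Real.log (1 + Real.exp (-((S i).2 * net φ (Θ lam) (S i).1))))
      (fun _ _ => (logistic_pos _).le) (Finset.mem_univ i)
  have h6 : Real.exp (-(γ / 2 * A)) ≤ 2 * n * Real.exp (-(A * (3 / 4 * γ))) := by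
    have := h5.trans (h3.trans h4)
    rw [one_div, inv_mul_le_iff₀ hn'] at this
    linarith
  have h7 : Real.exp (γ * A / 4) ≤ 2 * n := by
    have e1 : Real.exp (-(γ / 2 * A)) =
        Real.exp (γ * A / 4) * Real.exp (-(A * (3 / 4 * γ))) := by
      rw [← Real.exp_add]; ring_nf
    rw [e1] at h6
    exact le_of_mul_le_mul_right h6 (Real.exp_pos _)
  have h8 := (Real.le_log_iff_exp_le (by positivity)).2 h7
  rw [div_lt_iff₀ hγ] at ha2
  nlinarith

/-! ### Generalization from the normalized margin -/

lemma secondCountableTopology_params {d h : ℕ} (m : Fin h → ℕ) :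
    SecondCountableTopology (Params d m) := by
  have : ∀ a b : ℕ, SecondCountableTopology (Matrix (Fin a) (Fin b) ℝ) := fun a b =>
    inferInstanceAs (SecondCountableTopology (Fin a → Fin b → ℝ))
  infer_instance

/-- The clipped margin at scale `γ` of the network `Θ` on the labelled point `z`. -/
noncomputable def clippedMargin (φ : ℝ → ℝ) {d h : ℕ} {m : Fin h → ℕ} (γ : ℝ) (Θ : Params d m)
    (z : EuclideanSpace ℝ (Fin d) × ℝ) : ℝ :=
  clip γ (z.2 * net φ Θ z.1)

lemma measurable_clippedMargin {φ : ℝ → ℝ} (hφ : Continuous φ) {d h : ℕ} {m : Fin h → ℕ} (γ : ℝ)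
    (Θ : Params d m) : Measurable (clippedMargin φ γ Θ) :=
  ((continuous_clip γ).comp (continuous_snd.mul
    ((continuous_net hφ).comp (continuous_const.prodMk continuous_fst)))).measurable

lemma abs_clippedMargin_le (φ : ℝ → ℝ) {d h : ℕ} {m : Fin h → ℕ} (γ : ℝ) (Θ : Params d m)
    (z : EuclideanSpace ℝ (Fin d) × ℝ) : |clippedMargin φ γ Θ z| ≤ 1 := by
  rw [clippedMargin, abs_of_nonneg (clip_nonneg _ _)]
  exact clip_le_one _ _

lemma continuous_clippedMargin_left {φ : ℝ → ℝ} (hφ : Continuous φ) {d h : ℕ} {m : Fin h → ℕ}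
    (γ : ℝ) (z : EuclideanSpace ℝ (Fin d) × ℝ) :
    Continuous fun Θ : Params d m => clippedMargin φ γ Θ z :=
  (continuous_clip γ).comp (continuous_const.mul (continuous_net_left hφ _))

/-- The sum over the sample of the deviations of the clipped margin from its mean. -/
noncomputable def deviation (φ : ℝ → ℝ) {d h n : ℕ} {m : Fin h → ℕ}
    (p : Measure (EuclideanSpace ℝ (Fin d) × ℝ)) (γ : ℝ) (S : Sample d n) (Θ : Params d m) : ℝ :=
  ∑ i, clippedMargin φ γ Θ (S i) - n * ∫ z, clippedMargin φ γ Θ z ∂p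

lemma continuous_deviation {φ : ℝ → ℝ} (hφ : Continuous φ) {d h n : ℕ} {m : Fin h → ℕ}
    (p : Measure (EuclideanSpace ℝ (Fin d) × ℝ)) [IsProbabilityMeasure p] (γ : ℝ)
    (S : Sample d n) : Continuous fun Θ : Params d m => deviation φ p γ S Θ := by
  have := secondCountableTopology_params (d := d) m
  refine (continuous_finsetSum _ fun i _ => continuous_clippedMargin_left hφ γ _).sub
    (continuous_const.mul ?_)
  exact continuous_of_dominated (bound := fun _ => 1)
    (fun Θ => (measurable_clippedMargin hφ γ Θ).aestronglyMeasurable)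
    (fun Θ => ae_of_all _ fun z => abs_clippedMargin_le φ γ Θ z) (integrable_const _)
    (ae_of_all _ fun z => continuous_clippedMargin_left hφ γ z)

lemma measurable_deviation {φ : ℝ → ℝ} (hφ : Continuous φ) {d h n : ℕ} {m : Fin h → ℕ}
    (p : Measure (EuclideanSpace ℝ (Fin d) × ℝ)) (γ : ℝ) (Θ : Params d m) :
    Measurable fun S : Sample d n => deviation φ p γ S Θ :=
  (Finset.measurable_sum _ fun i _ =>
    (measurable_clippedMargin hφ γ Θ).comp (measurable_pi_apply i)).sub_const _

/-- If all margins on the sample are at least `γ`, the clipped margins have empirical mean `1`, so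
the deviation dominates the population error. -/
lemma testError_le_deviation {φ : ℝ → ℝ} (hφ : Continuous φ) {d h n : ℕ} {m : Fin h → ℕ}
    (p : Measure (EuclideanSpace ℝ (Fin d) × ℝ)) [IsProbabilityMeasure p] {γ : ℝ} (hγ : 0 < γ)
    {S : Sample d n} {Θ : Params d m} (hm : ∀ i, γ ≤ (S i).2 * net φ Θ (S i).1) :
    n * testError φ p Θ ≤ deviation φ p γ S Θ := by
  have h1 : ∑ i, clippedMargin φ γ Θ (S i) = n := by
    rw [Finset.sum_congr rfl fun i _ => show clippedMargin φ γ Θ (S i) = 1 from clip_of_le hγ (hm i)]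
    simp
  have hms : MeasurableSet {z : EuclideanSpace ℝ (Fin d) × ℝ | z.2 * net φ Θ z.1 ≤ 0} :=
    measurableSet_le (continuous_snd.mul ((continuous_net hφ).comp
      (continuous_const.prodMk continuous_fst))).measurable measurable_const
  have h2 : ∫ z, clippedMargin φ γ Θ z ∂p ≤ 1 - testError φ p Θ := by
    have e1 : 1 - testError φ p Θ = ∫ z, (1 - Set.indicator
        {z : EuclideanSpace ℝ (Fin d) × ℝ | z.2 * net φ Θ z.1 ≤ 0}
        (fun _ => (1 : ℝ)) z) ∂p := by
      rw [integral_sub (integrable_const _) ((integrable_const (1 : ℝ)).indicator hms),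
        integral_indicator_const _ hms]
      simp [testError]
    rw [e1]
    refine integral_mono (integrable_of_abs_le (measurable_clippedMargin hφ γ Θ)
      (abs_clippedMargin_le φ γ Θ))
      ((integrable_const _).sub ((integrable_const (1 : ℝ)).indicator hms)) fun z => ?_
    by_cases hz : z.2 * net φ Θ z.1 ≤ 0
    · have : clippedMargin φ γ Θ z = 0 := clip_of_nonpos hγ hz
      simp [this, hz]
    · have : clippedMargin φ γ Θ z ≤ 1 := clip_le_one _ _
      simpa [hz] using this
  rw [deviation, h1]
  nlinarith [(Nat.cast_nonneg n : (0 : ℝ) ≤ n)]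

/-- The bound on the Rademacher averages, times `n`, at scale `γ`. -/
noncomputable def radBound (h n : ℕ) (C γ : ℝ) : ℝ :=
  n * (2 * C / (γ * ((h : ℝ) + 1) ^ ((h : ℝ) / 2) * Real.sqrt n))

/-- Uniform deviation bound for a sequence of networks in the unit ball: monotone limit of the
bounds for finitely many of them. -/
lemma measure_exists_deviation_lt_le {φ : ℝ → ℝ} (hL : LipschitzWith 1 φ)
    (hh : ∀ c t : ℝ, 0 < c → φ (c * t) = c * φ t) {d h n : ℕ} (hn : 0 < n) {m : Fin h → ℕ}
    (p : Measure (EuclideanSpace ℝ (Fin d) × ℝ)) [IsProbabilityMeasure p] {C : ℝ} (hC : 0 < C)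
    (hp : ∀ᵐ z ∂p, ‖z.1‖ ≤ C ∧ |z.2| = 1) {γ : ℝ} (hγ : 0 < γ) (Θ : ℕ → Params d m)
    (hΘ : ∀ k, frobNorm (Θ k) ≤ 1) {t : ℝ} (ht : 0 ≤ t) :
    Measure.pi (fun _ : Fin n => p)
      {S | ∃ k, 2 * radBound h n C γ + t < deviation φ p γ S (Θ k)} ≤
      ENNReal.ofReal (Real.exp (-(2 * t ^ 2 / n))) := by
  have e1 : {S : Sample d n | ∃ k, 2 * radBound h n C γ + t < deviation φ p γ S (Θ k)} =
      ⋃ N : ℕ, {S : Sample d n | ∃ k : Fin (N + 1),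
        2 * radBound h n C γ + t < deviation φ p γ S (Θ k)} := by
    ext S
    simp only [Set.mem_iUnion]
    constructor
    · rintro ⟨k, hk⟩
      exact ⟨k, ⟨k, Nat.lt_succ_self k⟩, hk⟩
    · rintro ⟨N, k, hk⟩
      exact ⟨k, hk⟩
  have hmono : Monotone fun N : ℕ => {S : Sample d n | ∃ k : Fin (N + 1),
      2 * radBound h n C γ + t < deviation φ p γ S (Θ k)} := by
    rintro N N' hN S ⟨k, hk⟩
    exact ⟨⟨k, k.2.trans_le (by omega)⟩, hk⟩
  rw [e1, hmono.measure_iUnion]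
  refine iSup_le fun N => ?_
  rw [← ofReal_measureReal]
  refine ENNReal.ofReal_le_ofReal (measure_exists_deviation_le p hn
    (fun (k : Fin (N + 1)) => clippedMargin φ γ (Θ k))
    (fun k => measurable_clippedMargin hL.continuous γ _) (fun _ _ => clip_nonneg _ _)
    (fun _ _ => clip_le_one _ _) hp (R := radBound h n C γ) (fun S hS σ => ?_) ht)
  exact sum_sgn_mul_clip_le hL hh hn (fun k : Fin (N + 1) => Θ k) (fun k => hΘ k)
    (fun i => (S i).1) hC (fun i => (hS i).1) (fun i => (S i).2) (fun i => (hS i).2) hγ σ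

lemma exists_dense_unitBall {d h : ℕ} (m : Fin h → ℕ) :
    ∃ Θ : ℕ → Params d m, (∀ k, frobNorm (Θ k) ≤ 1) ∧
      ∀ F : Params d m → ℝ, Continuous F → ∀ b, (∀ k, F (Θ k) ≤ b) →
        ∀ Θ', frobNorm Θ' ≤ 1 → F Θ' ≤ b := by
  have := secondCountableTopology_params (d := d) m
  have : SecondCountableTopology {Θ : Params d m // frobNorm Θ ≤ 1} :=
    IsInducing.subtypeVal.secondCountableTopology
  have : Nonempty {Θ : Params d m // frobNorm Θ ≤ 1} :=
    ⟨⟨0, by rw [frobNorm_zero]; exact zero_le_one⟩⟩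
  refine ⟨fun k => (TopologicalSpace.denseSeq {Θ : Params d m // frobNorm Θ ≤ 1} k).1,
    fun k => (TopologicalSpace.denseSeq {Θ : Params d m // frobNorm Θ ≤ 1} k).2,
    fun F hF b hb Θ' hΘ' => ?_⟩
  exact (TopologicalSpace.denseRange_denseSeq {Θ : Params d m // frobNorm Θ ≤ 1}).induction_on
    (p := fun Θ => F Θ.1 ≤ b) ⟨Θ', hΘ'⟩
    (isClosed_le (hF.comp continuous_subtype_val) continuous_const) hb

/-- The failure probability allotted to the scale `C / 2 ^ j`. -/
noncomputable def scaleProb (δ : ℝ) (j : ℕ) : ℝ := δ / (((j : ℝ) + 1) * ((j : ℝ) + 2))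

lemma tsum_scaleProb_le {δ : ℝ} (hδ : 0 < δ) :
    ∑' j, ENNReal.ofReal (scaleProb δ j) ≤ ENNReal.ofReal δ := by
  refine ENNReal.tsum_le_of_sum_range_le fun N => ?_
  rw [← ENNReal.ofReal_sum_of_nonneg fun j _ => by unfold scaleProb; positivity]
  refine ENNReal.ofReal_le_ofReal ?_
  have : ∀ N : ℕ, ∑ j ∈ Finset.range N, scaleProb δ j = δ * (1 - 1 / ((N : ℝ) + 1)) := by
    intro N
    induction N with
    | zero => simp
    | succ N ih =>
      rw [Finset.sum_range_succ, ih, scaleProb]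
      push_cast
      field_simp
      ring
  rw [this]
  have h1 : 0 ≤ 1 / ((N : ℝ) + 1) := by positivity
  nlinarith

/-- The deviation allowed at the scale `C / 2 ^ j`. -/
noncomputable def scaleSlack (δ : ℝ) (n j : ℕ) : ℝ :=
  Real.sqrt (n * Real.log (1 / scaleProb δ j) / 2)

lemma exp_scaleSlack {δ : ℝ} (hδ : 0 < δ) (hδ1 : δ ≤ 1) {n : ℕ} (hn : 0 < n) (j : ℕ) :
    Real.exp (-(2 * scaleSlack δ n j ^ 2 / n)) = scaleProb δ j := by
  have hn' : (0 : ℝ) < n := by exact_mod_cast hn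
  have hj : (0 : ℝ) ≤ j := Nat.cast_nonneg j
  have hs : 0 < scaleProb δ j := by unfold scaleProb; positivity
  have hs1 : scaleProb δ j ≤ 1 := by
    unfold scaleProb
    rw [div_le_one (by positivity)]
    nlinarith
  have hlog : 0 ≤ Real.log (1 / scaleProb δ j) := Real.log_nonneg ((one_le_div hs).2 hs1)
  rw [scaleSlack, Real.sq_sqrt (by positivity)]
  have : -(2 * (n * Real.log (1 / scaleProb δ j) / 2) / n) = Real.log (scaleProb δ j) := by
    rw [one_div, Real.log_inv]
    field_simp
  rw [this, Real.exp_log hs]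

/-- The margin bound holds simultaneously for all dyadic scales and all networks in the unit ball,
on an event of probability at least `1 - δ`. -/
theorem exists_uniform_event {φ : ℝ → ℝ} (hL : LipschitzWith 1 φ)
    (hh : ∀ c t : ℝ, 0 < c → φ (c * t) = c * φ t) {d h n : ℕ} (hn : 0 < n) (m : Fin h → ℕ)
    (p : Measure (EuclideanSpace ℝ (Fin d) × ℝ)) [IsProbabilityMeasure p] {C : ℝ}
    (hp : ∀ᵐ z ∂p, ‖z.1‖ ≤ C ∧ |z.2| = 1) {δ : ℝ} (hδ : 0 < δ) (hδ1 : δ ≤ 1) :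
    ∃ E : Set (Sample d n), MeasurableSet E ∧
      ENNReal.ofReal (1 - δ) ≤ Measure.pi (fun _ : Fin n => p) E ∧
      ∀ S ∈ E, (∀ i, ‖(S i).1‖ ≤ C ∧ |(S i).2| = 1) ∧
        (0 < C → ∀ (j : ℕ) (Θ : Params d m), frobNorm Θ ≤ 1 →
          deviation φ p (C / 2 ^ j) S Θ ≤ 2 * radBound h n C (C / 2 ^ j) + scaleSlack δ n j) := by
  obtain ⟨T, hT, hdense⟩ := exists_dense_unitBall (d := d) m
  set B : ℕ → Set (Sample d n) := fun j => {S | ∃ k,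
    2 * radBound h n C (C / 2 ^ j) + scaleSlack δ n j < deviation φ p (C / 2 ^ j) S (T k)} with hB
  set G : Set (Sample d n) := {S | ∀ i, ‖(S i).1‖ ≤ C ∧ |(S i).2| = 1} with hG
  have hBm : MeasurableSet (⋃ j, B j) := by
    refine MeasurableSet.iUnion fun j => ?_
    have : B j = ⋃ k, {S | 2 * radBound h n C (C / 2 ^ j) + scaleSlack δ n j <
        deviation φ p (C / 2 ^ j) S (T k)} := by ext S; simp [hB]
    rw [this]
    exact MeasurableSet.iUnion fun k =>
      measurableSet_lt measurable_const (measurable_deviation hL.continuous p _ _)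
  have hGm : MeasurableSet G := by
    have : G = ⋂ i, {S : Sample d n | ‖(S i).1‖ ≤ C} ∩ {S : Sample d n | |(S i).2| = 1} := by
      ext S; simp [hG]
    rw [this]
    refine MeasurableSet.iInter fun i => MeasurableSet.inter ?_ ?_
    · exact measurableSet_le (measurable_pi_apply i).fst.norm measurable_const
    · exact measurableSet_eq_fun (continuous_abs.measurable.comp (measurable_pi_apply i).snd)
        measurable_const
  have hG0 : Measure.pi (fun _ : Fin n => p) Gᶜ = 0 := ae_pi_forall (n := n) hp
  have key : ∀ A : Set (Sample d n), MeasurableSet A →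
      Measure.pi (fun _ : Fin n => p) A ≤ ENNReal.ofReal δ →
      ENNReal.ofReal (1 - δ) ≤ Measure.pi (fun _ : Fin n => p) (A ∪ Gᶜ)ᶜ := by
    intro A hA hAδ
    rw [prob_compl_eq_one_sub (hA.union hGm.compl), ENNReal.ofReal_sub _ hδ.le, ENNReal.ofReal_one]
    refine tsub_le_tsub_left ((measure_union_le _ _).trans ?_) _
    rw [hG0, add_zero]
    exact hAδ
  by_cases hC : 0 < C
  · refine ⟨(⋃ j, B j ∪ Gᶜ)ᶜ, ?_, ?_, ?_⟩
    · rw [← Set.iUnion_union]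
      exact (hBm.union hGm.compl).compl
    · rw [← Set.iUnion_union]
      refine key _ hBm ((measure_iUnion_le _).trans ?_)
      refine (ENNReal.tsum_le_tsum fun j => ?_).trans (tsum_scaleProb_le hδ)
      rw [← exp_scaleSlack hδ hδ1 hn j]
      exact measure_exists_deviation_lt_le hL hh hn p hC hp (by positivity) T hT
        (Real.sqrt_nonneg _)
    · intro S hS
      rw [← Set.iUnion_union, Set.compl_union, compl_compl] at hS
      refine ⟨hS.2, fun _ j Θ hΘ => ?_⟩
      refine hdense _ (continuous_deviation hL.continuous p _ S) _ (fun k => ?_) Θ hΘ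
      by_contra hlt
      exact hS.1 (Set.mem_iUnion.2 ⟨j, k, not_le.1 hlt⟩)
  · refine ⟨(∅ ∪ Gᶜ)ᶜ, (MeasurableSet.empty.union hGm.compl).compl, key _ .empty (by simp), ?_⟩
    intro S hS
    rw [Set.empty_union, compl_compl] at hS
    exact ⟨hS, fun h => absurd h hC⟩

/-- A dyadic scale between a quarter and a half of the margin, of index at most
`log₂ (4 C / γ)`. -/
lemma exists_scale {C γ : ℝ} (hγ : 0 < γ) (hγC : γ ≤ C / 2) :
    ∃ j : ℕ, C / 2 ^ j ≤ γ / 2 ∧ γ / 4 ≤ C / 2 ^ j ∧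
      Real.log (((j : ℝ) + 1) * ((j : ℝ) + 2)) ≤ 3 * Real.log (Real.logb 2 (4 * C / γ)) := by
  have hC : 0 < C := by linarith
  set j := ⌈Real.logb 2 (2 * C / γ)⌉₊ with hj
  have h4 : 4 ≤ 2 * C / γ := by rw [le_div_iff₀ hγ]; linarith
  have hpos : 0 < 2 * C / γ := by positivity
  have hL : Real.logb 2 (4 * C / γ) = 1 + Real.logb 2 (2 * C / γ) := by
    rw [show 4 * C / γ = 2 * (2 * C / γ) by ring, Real.logb_mul (by norm_num) hpos.ne',
      Real.logb_self_eq_one (by norm_num)]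
  have h2 : 2 ≤ Real.logb 2 (2 * C / γ) := by
    rw [Real.le_logb_iff_rpow_le (by norm_num) hpos]
    norm_num
    exact h4
  have hj1 : Real.logb 2 (2 * C / γ) ≤ j := Nat.le_ceil _
  have hj2 : (j : ℝ) < Real.logb 2 (2 * C / γ) + 1 := Nat.ceil_lt_add_one (by linarith)
  have hp1 : 2 * C / γ ≤ 2 ^ j := by
    rw [← Real.rpow_natCast, ← Real.logb_le_iff_le_rpow (by norm_num) hpos]
    exact hj1
  have hp2 : (2 : ℝ) ^ j ≤ 4 * C / γ := by
    rw [← Real.rpow_natCast, ← Real.le_logb_iff_rpow_le (by norm_num) (by positivity), hL]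
    linarith
  refine ⟨j, ?_, ?_, ?_⟩
  · rw [div_le_iff₀ (by positivity)]
    rw [div_le_iff₀ hγ] at hp1
    linarith
  · rw [le_div_iff₀ (by positivity)]
    rw [le_div_iff₀ hγ] at hp2
    linarith
  · set L := Real.logb 2 (4 * C / γ) with hLdef
    have hL3 : 3 ≤ L := by linarith
    have hjL : (j : ℝ) ≤ L := by linarith
    have hj0 : (0 : ℝ) ≤ j := Nat.cast_nonneg j
    rw [show (3 : ℝ) * Real.log L = Real.log (L ^ 3) by rw [Real.log_pow]; norm_num]
    refine Real.log_le_log (by positivity) ?_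
    calc ((j : ℝ) + 1) * ((j : ℝ) + 2) ≤ (L + 1) * (L + 2) := by gcongr
      _ ≤ L ^ 3 := by
          have e1 : 0 ≤ (L - 3) * L ^ 2 := mul_nonneg (sub_nonneg.2 hL3) (sq_nonneg L)
          have e2 : 0 ≤ (L - 3) * L := mul_nonneg (sub_nonneg.2 hL3) (by linarith)
          nlinarith

/-- The bound at the dyadic scale, expressed through the margin itself. -/
lemma scale_bound_le {h n : ℕ} (hn : 0 < n) {C γ δ : ℝ} (hγ : 0 < γ) (hγC : γ ≤ C / 2)
    (hδ : 0 < δ) (hδ1 : δ ≤ 1) {j : ℕ} (hj : γ / 4 ≤ C / 2 ^ j)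
    (hjl : Real.log (((j : ℝ) + 1) * ((j : ℝ) + 2)) ≤ 3 * Real.log (Real.logb 2 (4 * C / γ))) :
    2 * radBound h n C (C / 2 ^ j) + scaleSlack δ n j ≤
      n * (16 * (C / (γ * ((h : ℝ) + 1) ^ ((h : ℝ) / 2) * Real.sqrt n) + epsTerm C δ n γ)) := by
  have hC : 0 < C := by linarith
  have hn' : (0 : ℝ) < n := by exact_mod_cast hn
  have hsn : 0 < Real.sqrt n := Real.sqrt_pos.2 hn'
  have hD : 0 < ((h : ℝ) + 1) ^ ((h : ℝ) / 2) := by positivity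
  set D := ((h : ℝ) + 1) ^ ((h : ℝ) / 2)
  set ℓ := Real.log (Real.logb 2 (4 * C / γ)) with hℓ
  have hj0 : (0 : ℝ) ≤ j := Nat.cast_nonneg j
  have hA : 1 ≤ ((j : ℝ) + 1) * ((j : ℝ) + 2) := by nlinarith
  have hℓ0 : 0 ≤ ℓ := by linarith [Real.log_nonneg hA]
  have hd0 : 0 ≤ Real.log (1 / δ) := Real.log_nonneg ((one_le_div hδ).2 hδ1)
  have h1 : radBound h n C (C / 2 ^ j) ≤ n * (8 * (C / (γ * D * Real.sqrt n))) := by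
    unfold radBound
    refine mul_le_mul_of_nonneg_left ?_ hn'.le
    calc 2 * C / (C / 2 ^ j * D * Real.sqrt n) ≤ 2 * C / (γ / 4 * D * Real.sqrt n) := by gcongr
      _ = _ := by
          field_simp
          norm_num
  have h2 : scaleSlack δ n j ≤ n * (2 * Real.sqrt (ℓ / n) + Real.sqrt (Real.log (1 / δ) / n)) := by
    have e1 : Real.log (1 / scaleProb δ j) ≤ 3 * ℓ + Real.log (1 / δ) := by
      have : 1 / scaleProb δ j = (((j : ℝ) + 1) * ((j : ℝ) + 2)) * (1 / δ) := by
        unfold scaleProb; field_simp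
      rw [this, Real.log_mul (by positivity) (by positivity)]
      linarith
    refine Real.sqrt_le_iff.2 ⟨by positivity, ?_⟩
    have s1 : Real.sqrt (ℓ / n) ^ 2 = ℓ / n := Real.sq_sqrt (by positivity)
    have s2 : Real.sqrt (Real.log (1 / δ) / n) ^ 2 = Real.log (1 / δ) / n :=
      Real.sq_sqrt (by positivity)
    have s3 : 0 ≤ Real.sqrt (ℓ / n) * Real.sqrt (Real.log (1 / δ) / n) := by positivity
    calc n * Real.log (1 / scaleProb δ j) / 2 ≤ n * (3 * ℓ + Real.log (1 / δ)) / 2 := by gcongr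
      _ ≤ n ^ 2 * (4 * (ℓ / n) + Real.log (1 / δ) / n) := by
          have : (n : ℝ) ^ 2 * (4 * (ℓ / n) + Real.log (1 / δ) / n) =
              n * (4 * ℓ + Real.log (1 / δ)) := by field_simp
          rw [this]
          nlinarith [mul_nonneg hn'.le hℓ0, mul_nonneg hn'.le hd0]
      _ ≤ (n * (2 * Real.sqrt (ℓ / n) + Real.sqrt (Real.log (1 / δ) / n))) ^ 2 := by
          rw [mul_pow]
          refine mul_le_mul_of_nonneg_left ?_ (by positivity)
          rw [add_sq, mul_pow, s1, s2]
          linarith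
  have r1 := Real.sqrt_nonneg (ℓ / n)
  have r2 := Real.sqrt_nonneg (Real.log (1 / δ) / n)
  have h3 : (n : ℝ) * (2 * Real.sqrt (ℓ / n) + Real.sqrt (Real.log (1 / δ) / n)) ≤
      n * (16 * epsTerm C δ n γ) := by
    refine mul_le_mul_of_nonneg_left ?_ hn'.le
    rw [epsTerm, ← hℓ]
    linarith
  linarith

lemma testError_smul {φ : ℝ → ℝ} (hh : ∀ c t : ℝ, 0 < c → φ (c * t) = c * φ t) {d h : ℕ}
    {m : Fin h → ℕ} (p : Measure (EuclideanSpace ℝ (Fin d) × ℝ)) (Θ : Params d m) {c : ℝ}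
    (hc : 0 < c) : testError φ p (c • Θ) = testError φ p Θ := by
  unfold testError
  congr 1
  ext z
  simp only [Set.mem_ofPred_eq]
  rw [net_smul hh _ hc.le, mul_left_comm]
  exact ⟨fun h => nonpos_of_mul_nonpos_right h (by positivity),
    fun h => mul_nonpos_of_nonneg_of_nonpos (by positivity) h⟩

/-- On the event of the uniform bound, the error of the minimizers is controlled for all small
regularization parameters: after normalization their margins are at least half the maximal one. -/
theorem eventually_testError_le {φ : ℝ → ℝ} (hL : LipschitzWith 1 φ)
    (hh : ∀ c t : ℝ, 0 < c → φ (c * t) = c * φ t) {d h n : ℕ} (hh1 : 1 ≤ h) (hn : 0 < n)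
    {m : Fin h → ℕ} (p : Measure (EuclideanSpace ℝ (Fin d) × ℝ)) [IsProbabilityMeasure p] {C δ : ℝ}
    (hδ : 0 < δ) (hδ1 : δ ≤ 1) {S : Sample d n} (hS : ∀ i, ‖(S i).1‖ ≤ C ∧ |(S i).2| = 1)
    (hdev : 0 < C → ∀ (j : ℕ) (Θ : Params d m), frobNorm Θ ≤ 1 →
      deviation φ p (C / 2 ^ j) S Θ ≤ 2 * radBound h n C (C / 2 ^ j) + scaleSlack δ n j)
    (hγ : 0 < maxMargin φ m S) {Θ : ℝ → Params d m}
    (hΘ : ∀ lam : ℝ, 0 < lam → IsMinOn (regLoss φ S lam) Set.univ (Θ lam)) :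
    ∀ᶠ lam in 𝓝[>] (0 : ℝ), testError φ p (Θ lam) ≤
      16 * (C / (maxMargin φ m S * ((h : ℝ) + 1) ^ ((h : ℝ) / 2) * Real.sqrt n) +
        epsTerm C δ n (maxMargin φ m S)) := by
  have hn' : (0 : ℝ) < n := by exact_mod_cast hn
  have hγC : maxMargin φ m S ≤ C / 2 :=
    maxMargin_le (abs_activation_le hL (activation_zero hh)) hh1 hn fun i => by
      rw [(hS i).2, one_mul]; exact (hS i).1
  have hC : 0 < C := by linarith
  obtain ⟨j, hj1, hj2, hj3⟩ := exists_scale hγ hγC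
  filter_upwards [eventually_half_maxMargin_le hL.continuous hh hn hγ hΘ] with lam hlam
  obtain ⟨ha, hm⟩ := hlam
  set a := frobNorm (Θ lam) with hadef
  have hunit : frobNorm (a⁻¹ • Θ lam) ≤ 1 := by
    rw [frobNorm_smul _ (inv_nonneg.2 ha.le), inv_mul_cancel₀ ha.ne']
  have hmargin : ∀ i, C / 2 ^ j ≤ (S i).2 * net φ (a⁻¹ • Θ lam) (S i).1 := fun i => by
    refine hj1.trans ?_
    rw [net_smul hh _ (inv_nonneg.2 ha.le), inv_pow, mul_left_comm, ← div_eq_inv_mul,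
      le_div_iff₀ (by positivity)]
    exact hm i
  have h1 := testError_le_deviation hL.continuous p (show 0 < C / 2 ^ j by positivity) hmargin
  rw [testError_smul hh p _ (inv_pos.2 ha)] at h1
  exact le_of_mul_le_mul_left
    (h1.trans ((hdev hC j _ hunit).trans (scale_bound_le hn hγ hγC hδ hδ1 hj2 hj3))) hn'

end MarginNet

theorem mainTheorem5 :
    ∃ K : ℝ, 0 < K ∧
      ∀ (q : ℕ) (_ : 2 ≤ q) (d : ℕ) (m : Fin (q - 1) → ℕ)
        (φ : ℝ → ℝ) (_ : LipschitzWith 1 φ) (_ : ∀ c t : ℝ, 0 < c → φ (c * t) = c * φ t)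
        (X : Set (EuclideanSpace ℝ (Fin d))) (_ : Bornology.IsBounded X)
        (p : Measure (EuclideanSpace ℝ (Fin d) × ℝ)) (_ : IsProbabilityMeasure p)
        (_ : ∀ᵐ z ∂p, z.1 ∈ X ∧ (z.2 = 1 ∨ z.2 = -1))
        (n : ℕ) (_ : 0 < n) (δ : ℝ) (_ : 0 < δ) (_ : δ ≤ 1),
        ∃ E : Set (MarginNet.Sample d n), MeasurableSet E ∧
          ENNReal.ofReal (1 - δ) ≤ Measure.pi (fun _ : Fin n => p) E ∧
          ∀ S ∈ E,
            (∀ lam : ℝ, 0 < lam → ∃ Θ : MarginNet.Params d m,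
              IsMinOn (MarginNet.regLoss φ S lam) Set.univ Θ) ∧
            (0 < MarginNet.maxMargin φ m S →
              ∀ Θ : ℝ → MarginNet.Params d m,
                (∀ lam : ℝ, 0 < lam →
                  IsMinOn (MarginNet.regLoss φ S lam) Set.univ (Θ lam)) →
                limsup (fun lam => MarginNet.testError φ p (Θ lam)) (𝓝[>] (0 : ℝ)) ≤
                  K * (MarginNet.dataRadius X /
                        (MarginNet.maxMargin φ m S * (q : ℝ) ^ (((q : ℝ) - 1) / 2)
                          * Real.sqrt n)
                      + MarginNet.epsTerm (MarginNet.dataRadius X) δ n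
                          (MarginNet.maxMargin φ m S))) := by
  refine ⟨16, by norm_num, ?_⟩
  intro q hq d m φ hL hh X hX p hprob hp n hn δ hδ hδ1
  obtain ⟨h, rfl⟩ : ∃ h, q = h + 1 := ⟨q - 1, by omega⟩
  have hbdd : BddAbove ((fun x : EuclideanSpace ℝ (Fin d) => ‖x‖) '' X) := by
    obtain ⟨R, hR⟩ := hX.exists_norm_le
    exact ⟨R, by rintro _ ⟨x, hx, rfl⟩; exact hR x hx⟩
  have hp' : ∀ᵐ z ∂p, ‖z.1‖ ≤ MarginNet.dataRadius X ∧ |z.2| = 1 := by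
    filter_upwards [hp] with z hz
    exact ⟨le_csSup hbdd ⟨z.1, hz.1, rfl⟩, by rcases hz.2 with h | h <;> simp [h]⟩
  obtain ⟨E, hE, hprobE, hES⟩ := MarginNet.exists_uniform_event hL hh hn (h := h) m p hp' hδ hδ1
  refine ⟨E, hE, hprobE, fun S hS => ⟨fun lam hlam =>
    MarginNet.exists_isMinOn_regLoss hL.continuous S hlam, fun hγ Θ hΘ => ?_⟩⟩
  have key := MarginNet.eventually_testError_le hL hh (by omega) hn p hδ hδ1 (hES S hS).1
    (hES S hS).2 hγ hΘ
  have e : ((h + 1 : ℕ) : ℝ) ^ ((((h + 1 : ℕ) : ℝ) - 1) / 2) = ((h : ℝ) + 1) ^ ((h : ℝ) / 2) := by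
    push_cast
    rw [add_sub_cancel_right]
  rw [e]
  -- the error is non-negative, so the upper limit is not a junk value
  exact limsup_le_of_le (isCoboundedUnder_le_of_le _ (x := 0) fun _ => measureReal_nonneg) key
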